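/- **Setting.** Let $\Omega\subset\mathbb R^d$ be open and bounded, and for $m\ge 0$ let $\mathcal M(\Omega;\mathbb R^{m})=C_0(\Omega;\mathbb R^m)^*$ be the space of finite $\mathbb R^m$-valued Borel measures on $\Omega$, with the Radon (total variation) norm $\|\mu\|_{\mathcal M}=|\mu|(\Omega)$. For $\gamma\in(0,\infty)$ let $|g|_\gamma=\|g\|_2-\frac1{2\gamma}$ if $\|g\|_2\ge 1/\gamma$ and $|g|_\gamma=\frac\gamma2\|g\|_2^2$ otherwise, and, if $\mu=h\,\mathcal L^d+\mu^s$ is the Lebesgue decomposition of $\mu$, put $\|\mu\|_{\gamma}=\int_\Omega |h(x)|_\gamma\,dx+|\mu^s|(\Omega)$; put $\|\mu\|_{\infty}=\|\mu\|_{\mathcal M}$. Let $X$ be a normed space that is the dual of a normed space $X_*$ (up to an equivalent norm), let $Y,Z$ be real Hilbert spaces, $K:X\to Y$ and $K_0:X\to Z$ bounded linear operators, $f\in\mathcal R(K)$, $f_0\in Z$, and $$F(u)=\tfrac12\|K_0u-f_0\|_Z^2,\qquad \Phi(v)=\tfrac12\|f-v\|_Y^2 .$$ Suppose that $\|K_0u\|_Z\le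 C_0\|Ku\|_Y$ for all $u\in X$, with a constant $C_0>0$. *Assumption KA.* $A_j:X\to\mathcal M(\Omega;\mathbb R^{m_j})$, $j=1,\dots,N$, are bounded linear operators; $K$ and all $A_j$ are weak* continuous (weak*-to-weak for $K$, weak*-to-weak* for $A_j$); $K^\dagger:\mathcal R(K)\to X$ is a linear right inverse of $K$, i.e. $KK^\dagger=I$ on $\mathcal R(K)$ (it may, but need not, be bounded); and $\sum_j\|A_ju\|_{\mathcal M}+\|Ku\|_Y$ is a norm on $X$ equivalent to the given one. *Assumption $\delta$.* For every $\ell\in\{1,\dots,N\}$ and $\delta>0$ there is $\bar f_{\delta,\ell}\in X$ with $\Phi(K\bar f_{\delta,\ell})<\delta+\inf\Phi$, $\|A_\ell\bar f_{\delta,\ell}\|_{\mathcal M}<\infty$ and $\sum_{j\ne\ell}\|A_j\bar f_{\delta,\ell}\|_{\mathcal M}=0$. Let $H:X\to[0,\infty]$ be convex, proper and weak* lower semicontinuous. For $\alpha\in[0,\infty]^N$, $\gamma\in(0,\infty]$, $\epsilon\in[0,\infty)$ put, with $0\cdot\infty=0$, $$J^{\gamma,\epsilon}_\alpha(u)=\epsilon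 H(u)+\Phi(Ku)+\sum_{j=1}^N\alpha_j\|A_ju\|_{\gamma}.$$ Write $u_{\alpha,\gamma,\epsilon}$ for any minimiser of $J^{\gamma,\epsilon}_\alpha$ over $X$ with $\epsilon H(u_{\alpha,\gamma,\epsilon})<\infty$. Problem $(\mathrm P^{\gamma,\epsilon})$ is to minimise $F(u_{\alpha,\gamma,\epsilon})$ over all $\alpha\in[0,\infty]^N$ and all such minimisers $u_{\alpha,\gamma,\epsilon}$; $\mathcal S(\gamma,\epsilon)\subset[0,\infty]^N$ is the set of its solutions $\alpha$; and $(\mathrm P)=(\mathrm P^{\infty,0})$. For $\alpha\in[0,\infty)^N$ and $v\in Y$ put $R_\alpha(v)=\inf\{\sum_j\alpha_j\|A_ju\|_{\mathcal M} : u\in X,\ Ku=v\}$. *Approximation property at $\gamma\in(0,\infty]$.* For every $\delta>0$, $\alpha\in[0,\infty]^N$ and $u\in X$ there is $u^\delta\in X$ with $H(u^\delta)<\infty$ and $J^{\gamma,0}_\alpha(u^\delta)\le J^{\gamma,0}_\alpha(u)+\delta$. *Assumption H*: $H(0)<\infty$, and the approximation property holds at $\gamma=\infty$. **Theorem.** Suppose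 Assumptions KA and $\delta$ hold, and that for some $\bar\alpha\in(0,\infty)^N$ and $t\in(0,1/C_0]$ $$R_{\bar\alpha}(f)>R_{\bar\alpha}\bigl(f-t(K_0K^\dagger)^*(K_0K^\dagger f-f_0)\bigr),$$ where $K_0K^\dagger$, which is bounded by $C_0$ on $\mathcal R(K)$, is extended to $\overline{\mathcal R(K)}$ to form the adjoint. Then: 1. Problem $(\mathrm P)$ has a solution $\hat\alpha\in(0,\infty]^N$. 2. If Assumption H also holds, there are $\bar\gamma,\bar\epsilon\in(0,\infty)$ such that - for every $(\gamma,\epsilon)\in[\bar\gamma,\infty]\times[0,\bar\epsilon]$ the problem $(\mathrm P^{\gamma,\epsilon})$ has a solution $\alpha_{\gamma,\epsilon}\in(0,\infty]^N$; - within $[\bar\gamma,\infty]\times[0,\bar\epsilon]$ the map $\mathcal S$ is outer semicontinuous at every $(\gamma,\epsilon)$ with $\epsilon>0$ and at every $(\gamma,0)$ such that the approximation property holds at $\gamma$ (in particular at $(\infty,0)$; and on the whole set if the approximation property holds at every $\gamma\in[\bar\gamma,\infty]$). That is, if $(\gamma^k,\epsilon^k)\to(\gamma,\epsilon)$ in $[\bar\gamma,\infty]\times[0,\bar\epsilon]$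 and $\mathcal S(\gamma^k,\epsilon^k)\ni\alpha^k\to\alpha$ in $[0,\infty]^N$, then $\alpha\in\mathcal S(\gamma,\epsilon)$; - $\gamma\mapsto\mathcal S(\gamma,0)$ is outer semicontinuous within $[\bar\gamma,\infty]$. -/

import Mathlib

open MeasureTheory Topology Filter Set
open scoped ENNReal NNReal ZeroAtInfty

noncomputable section

namespace Bilevel

/-! ### Vector measures, their total variation and its Huber regularisation -/

section Measures

variable {d m : ℕ} {Ω : Set (EuclideanSpace ℝ (Fin d))}

/-- The Radon norm `‖μ‖ = |μ|(Ω)` of an `ℝᵐ`-valued measure on `Ω`; the variation is taken with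
respect to the Euclidean norm of `ℝᵐ`. -/
def radonNorm (μ : VectorMeasure Ω (EuclideanSpace ℝ (Fin m))) : ℝ≥0∞ :=
  μ.variation univ

/-- The `i`-th component of an `ℝᵐ`-valued measure, a signed measure. -/
def component (i : Fin m) (μ : VectorMeasure Ω (EuclideanSpace ℝ (Fin m))) : SignedMeasure Ω :=
  μ.mapRange
    (EuclideanSpace.proj i : EuclideanSpace ℝ (Fin m) →L[ℝ] ℝ).toLinearMap.toAddMonoidHom
    (EuclideanSpace.proj i : EuclideanSpace ℝ (Fin m) →L[ℝ] ℝ).continuous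

/-- The Lebesgue measure on `Ω`. -/
def lebesgue (Ω : Set (EuclideanSpace ℝ (Fin d))) : Measure Ω := Measure.comap Subtype.val volume

/-- The density of the absolutely continuous part of `μ` in the Lebesgue decomposition with respect
to the Lebesgue measure on `Ω`. -/
def acDensity (μ : VectorMeasure Ω (EuclideanSpace ℝ (Fin m))) : Ω → EuclideanSpace ℝ (Fin m) :=
  fun x => WithLp.toLp 2 fun i => (component i μ).rnDeriv (lebesgue Ω) x

/-- The singular part of `μ` in the Lebesgue decomposition with respect to the Lebesgue measure. -/
def singularPart (μ : VectorMeasure Ω (EuclideanSpace ℝ (Fin m))) :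
    VectorMeasure Ω (EuclideanSpace ℝ (Fin m)) :=
  μ - (lebesgue Ω).withDensityᵥ (acDensity μ)

/-- The Huber regularisation of the Euclidean norm, for `γ ∈ (0, ∞]`. -/
def huber (γ : ℝ≥0∞) (g : EuclideanSpace ℝ (Fin m)) : ℝ :=
  if γ = ⊤ then ‖g‖
  else if 1 / γ.toReal ≤ ‖g‖ then ‖g‖ - 1 / (2 * γ.toReal)
  else γ.toReal / 2 * ‖g‖ ^ 2

/-- The Huber regularisation of the Radon norm; `γ = ∞` gives the Radon norm itself. -/
def huberNorm (γ : ℝ≥0∞) (μ : VectorMeasure Ω (EuclideanSpace ℝ (Fin m))) : ℝ≥0∞ :=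
  if γ = ⊤ then radonNorm μ
  else (∫⁻ x, ENNReal.ofReal (huber γ (acDensity μ x)) ∂lebesgue Ω)
    + radonNorm (singularPart μ)

end Measures

section Setting

variable {d N : ℕ} {Ω : Set (EuclideanSpace ℝ (Fin d))} {m : Fin N → ℕ}
variable {P X Y Z : Type*}
  [NormedAddCommGroup P] [NormedSpace ℝ P] [NormedAddCommGroup X] [NormedSpace ℝ X]
  [NormedAddCommGroup Y] [InnerProductSpace ℝ Y]
  [NormedAddCommGroup Z] [InnerProductSpace ℝ Z]

/-! ### Operators -/

/-- The weak* topology of `X`, seen as the dual of `P` through `ι`. -/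
abbrev weakStar (ι : X ≃L[ℝ] StrongDual ℝ P) : TopologicalSpace X :=
  TopologicalSpace.induced (fun u => StrongDual.toWeakDual (ι u)) inferInstance

/-- The assumptions on `A_j : X → M(Ω; ℝ^{m_j})`, `K : X → Y` and the right inverse `K†` of `K`.
Here `X` is the dual of `P`, `M(Ω; ℝ^{m_j})` is the dual of `C₀(Ω; ℝ^{m_j})`, and the Hilbert space
`Y` is its own dual. -/
structure AssumptionKA (ι : X ≃L[ℝ] StrongDual ℝ P)
    (A : ∀ j, X →ₗ[ℝ] VectorMeasure Ω (EuclideanSpace ℝ (Fin (m j))))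
    (K : X →L[ℝ] Y) (Kdag : LinearMap.range K.toLinearMap →ₗ[ℝ] X) : Prop where
  /-- The `A_j` are bounded. -/
  bounded : ∀ j, ∃ C : ℝ≥0, ∀ u, radonNorm (A j u) ≤ C * ‖u‖ₑ
  /-- The `A_j` are weak* continuous. -/
  weakStar_A : ∀ j (φ : C₀(Ω, EuclideanSpace ℝ (Fin (m j)))),
    Continuous[weakStar ι, inferInstance] fun u => ∫ᵛ x, φ x ∂[innerSL ℝ; A j u]
  /-- `K` is weak* continuous. -/
  weakStar_K : ∀ y : Y, Continuous[weakStar ι, inferInstance] fun u => inner ℝ y (K u)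
  /-- `K K† = I` on the range of `K`. -/
  right_inv : ∀ v, K (Kdag v) = v
  /-- `∑ ‖A_j u‖ + ‖K u‖` is equivalent to the norm of `X` (the other bound follows from
  boundedness). -/
  norm_equiv : ∃ C : ℝ≥0, ∀ u, ‖u‖ₑ ≤ C * (∑ j, radonNorm (A j u) + ‖K u‖ₑ)

/-- The Hilbert space adjoint `(K₀ K†)^* : Z → Y`, where `K₀ K†`, defined on the range of `K`, is
extended by continuity to the closure of that range. -/
def adjK0Kdag [CompleteSpace Y] [CompleteSpace Z] (K : X →L[ℝ] Y)
    (Kdag : LinearMap.range K.toLinearMap →ₗ[ℝ] X) (K0 : X →L[ℝ] Z) (z : Z) : Y :=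
  (ContinuousLinearMap.adjoint
    ((K0.toLinearMap ∘ₗ Kdag).extendOfNorm
      (Submodule.inclusion (LinearMap.range K.toLinearMap).le_topologicalClosure)) z :
    (LinearMap.range K.toLinearMap).topologicalClosure)

/-! ### Functionals -/

/-- The squared fidelity `Φ(v) = ½‖f - v‖²`. -/
def fidelity (f v : Y) : ℝ≥0∞ := ENNReal.ofReal (1 / 2 * ‖f - v‖ ^ 2)

/-- The squared cost `F(u) = ½‖K₀ u - f₀‖²`. -/
def cost (K0 : X →L[ℝ] Z) (f0 : Z) (u : X) : ℝ := 1 / 2 * ‖K0 u - f0‖ ^ 2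

/-- The regulariser `u ↦ ∑ α_j ‖A_j u‖_γ` with weights `α ∈ [0, ∞]^N` (and `∞ · 0 = 0 · ∞ = 0`). -/
def reg (A : ∀ j, X →ₗ[ℝ] VectorMeasure Ω (EuclideanSpace ℝ (Fin (m j))))
    (γ : ℝ≥0∞) (α : Fin N → ℝ≥0∞) (u : X) : ℝ≥0∞ :=
  ∑ j, α j * huberNorm γ (A j u)

/-- The marginal regulariser on `Y`: the infimum of the regulariser with `γ = ∞` over the preimage
of a point under `K`. -/
def marginal (A : ∀ j, X →ₗ[ℝ] VectorMeasure Ω (EuclideanSpace ℝ (Fin (m j))))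
    (K : X →L[ℝ] Y) (α : Fin N → ℝ≥0∞) (v : Y) : ℝ≥0∞ :=
  ⨅ (u : X) (_ : K u = v), reg A ⊤ α u

/-- The objective of the inner problem,
`J^{γ,ε}_α(u) = ε H(u) + Φ(K u) + ∑ α_j ‖A_j u‖_γ`. -/
def objective (A : ∀ j, X →ₗ[ℝ] VectorMeasure Ω (EuclideanSpace ℝ (Fin (m j))))
    (K : X →L[ℝ] Y) (f : Y) (H : X → ℝ≥0∞) (γ : ℝ≥0∞) (ε : ℝ≥0) (α : Fin N → ℝ≥0∞) (u : X) :
    ℝ≥0∞ :=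
  ε * H u + fidelity f (K u) + reg A γ α u

/-- The solutions `u_{α,γ,ε}` of the inner problem. -/
def reconstructions (A : ∀ j, X →ₗ[ℝ] VectorMeasure Ω (EuclideanSpace ℝ (Fin (m j))))
    (K : X →L[ℝ] Y) (f : Y) (H : X → ℝ≥0∞) (γ : ℝ≥0∞) (ε : ℝ≥0) (α : Fin N → ℝ≥0∞) : Set X :=
  {u | (ε : ℝ≥0∞) * H u ≠ ⊤ ∧ ∀ w, objective A K f H γ ε α u ≤ objective A K f H γ ε α w}

/-- The solution map `S(γ, ε) = argmin_α F(u_{α,γ,ε})` of the bilevel problem, the minimum being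
over all `α ∈ [0, ∞]^N` and all solutions `u_{α,γ,ε}` of the inner problem. -/
def solutionMap (A : ∀ j, X →ₗ[ℝ] VectorMeasure Ω (EuclideanSpace ℝ (Fin (m j))))
    (K : X →L[ℝ] Y) (K0 : X →L[ℝ] Z) (f : Y) (f0 : Z) (H : X → ℝ≥0∞) (p : ℝ≥0∞ × ℝ≥0) :
    Set (Fin N → ℝ≥0∞) :=
  {α | ∃ u ∈ reconstructions A K f H p.1 p.2 α,
    ∀ α', ∀ u' ∈ reconstructions A K f H p.1 p.2 α', cost K0 f0 u ≤ cost K0 f0 u'}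

/-! ### Remaining assumptions -/

/-- Order reduction. -/
def AssumptionDelta (A : ∀ j, X →ₗ[ℝ] VectorMeasure Ω (EuclideanSpace ℝ (Fin (m j))))
    (K : X →L[ℝ] Y) (f : Y) : Prop :=
  ∀ ℓ : Fin N, ∀ δ : ℝ≥0, 0 < δ → ∃ u : X,
    fidelity f (K u) < δ + ⨅ v, fidelity f v ∧
    radonNorm (A ℓ u) < ⊤ ∧
    ∑ j ∈ Finset.univ.erase ℓ, radonNorm (A j u) = 0

/-- The standing assumption on the smoothing functional: convex, proper and weak* lower
semicontinuous. -/
structure IsSmoothing (ι : X ≃L[ℝ] StrongDual ℝ P) (H : X → ℝ≥0∞) : Prop where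
  convex : ∀ u v : X, ∀ a b : ℝ≥0, a + b = 1 → H (a • u + b • v) ≤ a * H u + b * H v
  proper : ∃ u, H u ≠ ⊤
  lsc : @LowerSemicontinuous X ℝ≥0∞ (weakStar ι) _ H

/-- The approximation property at `γ`: for all `α`, values of `J^{γ,0}_α` are approximated from above within the domain of `H`. -/
def SmoothApprox (A : ∀ j, X →ₗ[ℝ] VectorMeasure Ω (EuclideanSpace ℝ (Fin (m j))))
    (K : X →L[ℝ] Y) (f : Y) (H : X → ℝ≥0∞) (γ : ℝ≥0∞) : Prop :=
  ∀ δ : ℝ≥0, 0 < δ → ∀ (α : Fin N → ℝ≥0∞) (u : X), ∃ w : X,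
    H w < ⊤ ∧ objective A K f H γ 0 α w ≤ objective A K f H γ 0 α u + δ

/-- The smoothing assumption: `0` is in the domain of `H`, and the approximation property holds for
the unregularised objective `J_α = J^{∞,0}_α`. -/
def AssumptionH (A : ∀ j, X →ₗ[ℝ] VectorMeasure Ω (EuclideanSpace ℝ (Fin (m j))))
    (K : X →L[ℝ] Y) (f : Y) (H : X → ℝ≥0∞) : Prop :=
  H 0 < ⊤ ∧ SmoothApprox A K f H ⊤

end Setting

/-- Outer semicontinuity of a set-valued map at a point `x` of `D`, along sequences in `D`. -/
def OuterSemicontinuousWithinAt {E G : Type*} [TopologicalSpace E] [TopologicalSpace G]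
    (S : E → Set G) (D : Set E) (x : E) : Prop :=
  ∀ (x' : ℕ → E) (y' : ℕ → G) (y : G), (∀ k, x' k ∈ D) → (∀ k, y' k ∈ S (x' k)) →
    Tendsto x' atTop (𝓝 x) → Tendsto y' atTop (𝓝 y) → y ∈ S x

end Bilevel

end

/-!
The proof compares outer costs on three kinds of weights.

*Weights with a small component are too costly.* The order reduction provides, for each `ℓ`, a
competitor `w ℓ` that nearly fits the data and at which only the `ℓ`-th regulariser is nonzero. If
`α ℓ` is small, the inner objective at `w ℓ` is small, so every solution of the inner problem nearly
fits the data (`exists_weight_threshold`), and its outer cost is nearly that of exact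
reconstructions, because `K₀` is dominated by `K` (`exists_fidelity_bound`). For `ε > 0` the
competitors have to lie in the domain of `H`; the approximation property at `γ = ∞`, applied with
weight `0` at `ℓ` and `∞` elsewhere, moves them there (`exists_smooth_competitors`).

*Some positive weights are cheaper.* By convexity of the marginal the strict inequality in the
hypothesis also holds for small steps. As the weights `s α` tend to zero, the regulariser at their
solutions is asymptotically at least its marginal at `f`, hence exceeds its value at a competitor
`v` with `K v = f - τ g`, where `g = (K₀ K†)^* (K₀ K† f - f₀)`. The variational inequality at the
solution `u`, tested against `v`, then reads `‖f - K u‖² < τ ⟪f - K u, g⟫`, and with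
`τ ≤ 2 / C₀²` this makes the outer cost at `u` smaller than that of exact reconstructions
(`exists_cost_lt`).

*Weights bounded away from zero behave continuously.* The image `K u` of a solution `u` of the inner
problem is unique, and depends continuously on `(γ, ε, α)` where the approximation property or
`ε > 0` allows the passage to the limit (`tendsto_K_reconstructions`). The outer cost depends only
on `K u`. As `[0, ∞]^N` is compact, minimising sequences of weights have limit points, and these are
solutions with positive weights. The same stability at `(∞, 0)` keeps the cheap weights cheap on a
rectangle of parameters (`exists_rectangle_cost_lt`), and gives the outer semicontinuity on it.

Stability is the direct method, carried out along ultrafilters. It rests on a dual formula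
(`huberNorm_eq_iSup`): for `γ ∈ (0, ∞]`, the Huber norm of `μ` is the supremum of
`∫ φ · dμ - (2γ)⁻¹ ∫ |φ|²` over the `φ ∈ C₀` with `‖φ‖ ≤ 1`. Its proof chooses the pointwise optimal
direction for the density on the complement of a null set that carries the singular part, and an
almost norming function for the singular part on that null set, and approximates the result by
functions in `C₀`. The formula yields the joint lower semicontinuity in `γ` and `μ` (weakly*), the
convexity in `μ`, the monotonicity and continuity in `γ`, and the bound of the Radon norm by the
Huber norm plus a constant, from which coercivity follows.
-/

namespace Bilevel

/-! ### Integration against vector measures -/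

section VectorIntegral

variable {S E : Type*} [MeasurableSpace S] [NormedAddCommGroup E] [InnerProductSpace ℝ E]

theorem isFiniteMeasure_variation_withDensityᵥ [CompleteSpace E] {ρ : Measure S} {h : S → E}
    (hh : Integrable h ρ) : IsFiniteMeasure (ρ.withDensityᵥ h).variation := by
  rw [Measure.variation_withDensityᵥ hh]
  exact isFiniteMeasure_withDensity hh.2.ne

theorem integral_indicator_const_inner [CompleteSpace E] (μ : VectorMeasure S E)
    [IsFiniteMeasure μ.variation] {s : Set S} (hs : MeasurableSet s) (v : E) :
    ∫ᵛ x, s.indicator (fun _ => v) x ∂[innerSL ℝ; μ] = inner ℝ v (μ s) := by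
  rw [VectorMeasure.integral_indicator hs, VectorMeasure.integral_const,
    VectorMeasure.restrict_apply _ hs MeasurableSet.univ, univ_inter, innerSL_apply_apply]

/-- Integration against a vector measure with density is integration of the inner product with the
density. -/
theorem integral_withDensityᵥ_inner [CompleteSpace E] {ρ : Measure S} {h g : S → E}
    (hh : Integrable h ρ) (hg : StronglyMeasurable g) {C : ℝ} (hC : ∀ x, ‖g x‖ ≤ C) :
    ∫ᵛ x, g x ∂[innerSL ℝ; ρ.withDensityᵥ h] = ∫ x, inner ℝ (g x) (h x) ∂ρ := by
  have hfin := isFiniteMeasure_variation_withDensityᵥ hh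
  rcases isEmpty_or_nonempty S with hS | ⟨⟨x₀⟩⟩
  · rw [VectorMeasure.integral_of_isEmpty]
    simp [Measure.eq_zero_of_isEmpty ρ]
  have hC0 : 0 ≤ C := (norm_nonneg _).trans (hC x₀)
  have hint : ∀ f : SimpleFunc S E, Integrable (fun x => inner ℝ (f x) (h x) : S → ℝ) ρ := by
    intro f
    obtain ⟨D, hD⟩ := f.exists_forall_norm_le
    refine Integrable.mono' (hh.norm.const_mul D)
      (f.aestronglyMeasurable.inner hh.aestronglyMeasurable) (ae_of_all _ fun x => ?_)
    exact (norm_inner_le_norm _ _).trans (mul_le_mul_of_nonneg_right (hD x) (norm_nonneg _))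
  have hsimple : ∀ f : SimpleFunc S E,
      ∫ᵛ x, f x ∂[innerSL ℝ; ρ.withDensityᵥ h] = ∫ x, inner ℝ (f x) (h x) ∂ρ := by
    intro f
    induction f using SimpleFunc.induction with
    | const c hs =>
      rename_i s
      have h1 : ⇑(SimpleFunc.piecewise s hs (SimpleFunc.const S c) (SimpleFunc.const S 0))
          = s.indicator fun _ => c := by
        ext1 x; by_cases hx : x ∈ s <;> simp [hx]
      rw [h1, integral_indicator_const_inner _ hs, withDensityᵥ_apply hh hs]
      have h2 : (fun x => inner ℝ (s.indicator (fun _ => c) x) (h x) : S → ℝ)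
          = s.indicator fun x => inner ℝ c (h x) := by
        ext1 x; by_cases hx : x ∈ s <;> simp [hx]
      rw [h2, MeasureTheory.integral_indicator hs]
      exact ((innerSL ℝ c).integral_comp_comm hh.integrableOn).symm
    | add hfg hf hg =>
      rename_i f g
      have h1 : ∀ f : SimpleFunc S E, (ρ.withDensityᵥ h).Integrable f := fun f =>
        f.integrable_of_isFiniteMeasure
      simp only [SimpleFunc.coe_add, Pi.add_apply, inner_add_left]
      rw [VectorMeasure.integral_fun_add (h1 f) (h1 g), hf, hg,
        MeasureTheory.integral_add (hint f) (hint g)]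
  have hlim1 : Tendsto (fun n => ∫ᵛ x, hg.approxBounded C n x ∂[innerSL ℝ; ρ.withDensityᵥ h])
      atTop (𝓝 (∫ᵛ x, g x ∂[innerSL ℝ; ρ.withDensityᵥ h])) :=
    VectorMeasure.tendsto_integral_filter_of_norm_le_const
    (Eventually.of_forall fun n => (hg.approxBounded C n).aestronglyMeasurable)
    ⟨C, Eventually.of_forall fun n => ae_of_all _ fun x => hg.norm_approxBounded_le hC0 n x⟩
    (ae_of_all _ fun x => hg.tendsto_approxBounded_of_norm_le (hC x))
  have hlim2 : Tendsto (fun n => ∫ x, inner ℝ (hg.approxBounded C n x) (h x) ∂ρ) atTop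
      (𝓝 (∫ x, inner ℝ (g x) (h x) ∂ρ)) := by
    refine MeasureTheory.tendsto_integral_of_dominated_convergence (fun x => C * ‖h x‖)
      (fun n => (hint _).aestronglyMeasurable) (hh.norm.const_mul C) (fun n => ae_of_all _ fun x =>
        (norm_inner_le_norm _ _).trans (mul_le_mul_of_nonneg_right
          (hg.norm_approxBounded_le hC0 n x) (norm_nonneg _))) (ae_of_all _ fun x => ?_)
    exact (hg.tendsto_approxBounded_of_norm_le (hC x)).inner tendsto_const_nhds
  refine tendsto_nhds_unique hlim1 ?_
  simpa only [hsimple] using hlim2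

end VectorIntegral

/-! ### Density of `C₀` in the unit ball of bounded measurable functions -/

/-- An `L¹` approximation by compactly supported functions, retracted radially onto the unit
ball. -/
theorem exists_zeroAtInfty_approx {S E : Type*} [TopologicalSpace S] [R1Space S] [NormalSpace S]
    [WeaklyLocallyCompactSpace S] [MeasurableSpace S] [BorelSpace S] [NormedAddCommGroup E]
    [NormedSpace ℝ E] (ν : Measure S) [ν.Regular] {g : S → E} (hg : Integrable g ν)
    (hg1 : ∀ x, ‖g x‖ ≤ 1) {ε : ℝ} (hε : 0 < ε) :
    ∃ φ : C₀(S, E), (∀ x, ‖φ x‖ ≤ 1) ∧ Integrable φ ν ∧ ∫ x, ‖g x - φ x‖ ∂ν ≤ ε := by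
  obtain ⟨ψ, hψc, hψi, hψ, hψint⟩ := hg.exists_hasCompactSupport_integral_sub_le (half_pos hε)
  -- The radial retraction onto the unit ball.
  let r : E → E := fun y => (max 1 ‖y‖)⁻¹ • y
  have hr0 : r 0 = 0 := smul_zero _
  have hpos : ∀ y : E, 0 < max 1 ‖y‖ := fun y => lt_max_of_lt_left one_pos
  have hrcont : Continuous r :=
    ((continuous_const.max continuous_norm).inv₀ fun y => (hpos y).ne').smul continuous_id
  have hr1 : ∀ y, ‖r y‖ ≤ 1 := by
    intro y
    rw [norm_smul, norm_inv, Real.norm_of_nonneg (hpos y).le, inv_mul_le_iff₀ (hpos y), mul_one]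
    exact le_max_right _ _
  have hrle : ∀ y, ‖r y‖ ≤ ‖y‖ := by
    intro y
    rw [norm_smul, norm_inv, Real.norm_of_nonneg (hpos y).le, inv_mul_le_iff₀ (hpos y)]
    exact le_mul_of_one_le_left (norm_nonneg _) (le_max_left _ _)
  have hrdist : ∀ x y : E, ‖x‖ ≤ 1 → ‖x - r y‖ ≤ 2 * ‖x - y‖ := by
    intro x y hx
    have h1 : ‖y - r y‖ ≤ ‖x - y‖ := by
      rcases le_total ‖y‖ 1 with hy | hy
      · have : r y = y := by simp [r, max_eq_left hy]
        simp [this]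
      · have h2 : y - r y = (1 - ‖y‖⁻¹) • y := by simp [r, max_eq_right hy, sub_smul]
        have h3 : 0 ≤ 1 - ‖y‖⁻¹ := sub_nonneg.2 (inv_le_one_of_one_le₀ hy)
        rw [h2, norm_smul, Real.norm_of_nonneg h3, sub_mul, one_mul,
          inv_mul_cancel₀ (by linarith : ‖y‖ ≠ 0)]
        have := norm_sub_norm_le y x
        rw [norm_sub_rev] at this
        linarith
    calc ‖x - r y‖ = ‖(x - y) + (y - r y)‖ := by rw [sub_add_sub_cancel]
      _ ≤ ‖x - y‖ + ‖y - r y‖ := norm_add_le _ _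
      _ ≤ 2 * ‖x - y‖ := by linarith
  have hφc : HasCompactSupport (r ∘ ψ) := hψc.comp_left hr0
  let φ : C₀(S, E) := ⟨⟨r ∘ ψ, hrcont.comp hψ⟩, hφc.is_zero_at_infty⟩
  have hφint : Integrable φ ν :=
    hψint.mono (hrcont.comp_aestronglyMeasurable hψint.1) (ae_of_all _ fun x => hrle (ψ x))
  refine ⟨φ, fun x => hr1 _, hφint, ?_⟩
  calc ∫ x, ‖g x - φ x‖ ∂ν ≤ ∫ x, 2 * ‖g x - ψ x‖ ∂ν :=
        integral_mono (hg.sub hφint).norm ((hg.sub hψint).norm.const_mul 2)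
          fun x => hrdist _ _ (hg1 x)
    _ = 2 * ∫ x, ‖g x - ψ x‖ ∂ν := integral_const_mul _ _
    _ ≤ ε := by linarith

/-! ### The Lebesgue decomposition of an `ℝᵐ`-valued measure -/

/-- A vector measure carried by `N` is almost normed by a measurable function with values in the
unit ball that vanishes outside `N`. -/
theorem exists_almost_norming {S E : Type*} [MeasurableSpace S] [NormedAddCommGroup E]
    [InnerProductSpace ℝ E] [CompleteSpace E] (σ : VectorMeasure S E)
    [IsFiniteMeasure σ.variation] {N : Set S} (hN : MeasurableSet N)
    (hσ : ∀ t, MeasurableSet t → t ⊆ Nᶜ → σ t = 0) {ε : ℝ} (hε : 0 < ε) :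
    ∃ g : S → E, StronglyMeasurable g ∧ (∀ x, ‖g x‖ ≤ 1) ∧ (∀ x, x ∉ N → g x = 0) ∧
      (σ.variation univ).toReal ≤ (∫ᵛ x, g x ∂[innerSL ℝ; σ]) + ε := by
  classical
  obtain ⟨P, -, hPd, hPm, hP⟩ := σ.exists_variation_le_add (ε := ε.toNNReal) MeasurableSet.univ
    (by simpa using hε) (measure_ne_top _ _)
  let v : Set S → E := fun p => ‖σ p‖⁻¹ • σ p
  have hv : ∀ p, ‖v p‖ ≤ 1 := fun p => by
    rw [norm_smul, norm_inv, norm_norm]; exact inv_mul_le_one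
  let g : S → E := fun x => ∑ p ∈ P, (p ∩ N).indicator (fun _ => v p) x
  have hind : ∀ p ∈ P, StronglyMeasurable ((p ∩ N).indicator fun _ => v p) := fun p hp =>
    stronglyMeasurable_const.indicator ((hPm p hp).inter hN)
  have hint : ∀ p ∈ P, σ.Integrable ((p ∩ N).indicator fun _ => v p) := fun p hp =>
    (integrable_const _).indicator ((hPm p hp).inter hN)
  refine ⟨g, Finset.stronglyMeasurable_fun_sum P hind, fun x => ?_, fun x hx => ?_, ?_⟩
  · by_cases h : ∃ p ∈ P, x ∈ p ∩ N
    · obtain ⟨p, hp, hxp⟩ := h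
      have : g x = v p := by
        refine (Finset.sum_eq_single_of_mem p hp fun q hq hqp => ?_).trans
          (indicator_of_mem hxp _)
        refine indicator_of_notMem (fun hxq => ?_) _
        exact (hPd hq hp hqp).le_bot ⟨hxq.1, hxp.1⟩
      rw [this]; exact hv p
    · have : g x = 0 := Finset.sum_eq_zero fun p hp =>
        indicator_of_notMem (fun hxp => h ⟨p, hp, hxp⟩) _
      simp [this]
  · exact Finset.sum_eq_zero fun p _ => indicator_of_notMem (fun h => hx h.2) _
  · have hpN : ∀ p ∈ P, σ (p ∩ N) = σ p := fun p hp => by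
      have h0 := hσ (p \ N) ((hPm p hp).diff hN) fun x hx => hx.2
      conv_rhs => rw [← inter_union_sdiff p N]
      rw [VectorMeasure.of_union (disjoint_sdiff_right.mono_left inter_subset_right)
        ((hPm p hp).inter hN) ((hPm p hp).diff hN), h0, add_zero]
    have hI : ∫ᵛ x, g x ∂[innerSL ℝ; σ] = ∑ p ∈ P, ‖σ p‖ := by
      rw [VectorMeasure.integral_finsetSum P hint]
      refine Finset.sum_congr rfl fun p hp => ?_
      rw [integral_indicator_const_inner _ ((hPm p hp).inter hN), hpN p hp, real_inner_smul_left,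
        real_inner_self_eq_norm_sq]
      rcases eq_or_ne ‖σ p‖ 0 with h | h
      · simp [h]
      · field_simp
    rw [hI]
    have h1 : (∑ p ∈ P, ‖σ p‖ₑ) = ENNReal.ofReal (∑ p ∈ P, ‖σ p‖) := by
      rw [ENNReal.ofReal_sum_of_nonneg fun p _ => norm_nonneg _]
      simp only [ofReal_norm]
    have h0 : 0 ≤ ∑ p ∈ P, ‖σ p‖ := Finset.sum_nonneg fun p _ => norm_nonneg _
    rw [h1] at hP
    change _ ≤ _ + ENNReal.ofReal ε at hP
    rw [← ENNReal.ofReal_add h0 hε.le] at hP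
    exact ENNReal.toReal_le_of_le_ofReal (by positivity) hP

section Decomposition

variable {d m : ℕ} {Ω : Set (EuclideanSpace ℝ (Fin d))}

theorem isFiniteMeasure_lebesgue (hΩ : IsOpen Ω) (hΩb : Bornology.IsBounded Ω) :
    IsFiniteMeasure (lebesgue Ω) := by
  constructor
  rw [lebesgue, (MeasurableEmbedding.subtype_coe hΩ.measurableSet).comap_apply]
  simpa using hΩb.measure_lt_top

theorem acDensity_eq_sum (μ : VectorMeasure Ω (EuclideanSpace ℝ (Fin m))) :
    acDensity μ = fun x => ∑ i, (component i μ).rnDeriv (lebesgue Ω) x •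
      EuclideanSpace.basisFun (Fin m) ℝ i := by
  ext x i
  simp [acDensity, Pi.single_apply]

theorem stronglyMeasurable_acDensity (μ : VectorMeasure Ω (EuclideanSpace ℝ (Fin m))) :
    StronglyMeasurable (acDensity μ) := by
  rw [acDensity_eq_sum]
  exact Finset.stronglyMeasurable_fun_sum _ fun i _ =>
    (SignedMeasure.measurable_rnDeriv _ _).stronglyMeasurable.smul_const _

theorem integrable_acDensity (μ : VectorMeasure Ω (EuclideanSpace ℝ (Fin m))) :
    Integrable (acDensity μ) (lebesgue Ω) := by
  rw [acDensity_eq_sum]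
  exact integrable_finsetSum _ fun i _ => (SignedMeasure.integrable_rnDeriv _ _).smul_const _

theorem isFiniteMeasure_variation {μ : VectorMeasure Ω (EuclideanSpace ℝ (Fin m))}
    (hμ : radonNorm μ ≠ ⊤) : IsFiniteMeasure μ.variation :=
  ⟨lt_top_iff_ne_top.2 hμ⟩

theorem isFiniteMeasure_variation_singularPart {μ : VectorMeasure Ω (EuclideanSpace ℝ (Fin m))}
    (hμ : radonNorm μ ≠ ⊤) : IsFiniteMeasure (singularPart μ).variation := by
  have h1 := isFiniteMeasure_variation hμ
  have h2 := isFiniteMeasure_variation_withDensityᵥ (integrable_acDensity μ)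
  exact isFiniteMeasure_of_le _ VectorMeasure.variation_sub_le

theorem singularPart_add_withDensityᵥ (μ : VectorMeasure Ω (EuclideanSpace ℝ (Fin m))) :
    singularPart μ + (lebesgue Ω).withDensityᵥ (acDensity μ) = μ :=
  sub_add_cancel _ _

theorem singularPart_apply [IsFiniteMeasure (lebesgue Ω)]
    (μ : VectorMeasure Ω (EuclideanSpace ℝ (Fin m)))
    {t : Set Ω} (ht : MeasurableSet t) (i : Fin m) :
    singularPart μ t i = (component i μ).singularPart (lebesgue Ω) t := by
  have h1 := congrArg (fun ν : SignedMeasure Ω => ν t)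
    ((component i μ).singularPart_add_withDensity_rnDeriv_eq (lebesgue Ω))
  simp only [_root_.add_apply, withDensityᵥ_apply (SignedMeasure.integrable_rnDeriv _ _) ht]
    at h1
  have h2 : (∫ x in t, acDensity μ x ∂lebesgue Ω) i
      = ∫ x in t, (component i μ).rnDeriv (lebesgue Ω) x ∂lebesgue Ω :=
    ((EuclideanSpace.proj i : EuclideanSpace ℝ (Fin m) →L[ℝ] ℝ).integral_comp_comm
      (integrable_acDensity μ).integrableOn).symm
  have h3 : component i μ t = μ t i := rfl
  rw [singularPart, _root_.sub_apply, withDensityᵥ_apply (integrable_acDensity μ) ht,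
    PiLp.sub_apply, h2, ← h3]
  linarith

/-- The singular part is carried by a Lebesgue null set. -/
theorem exists_null_carrier_singularPart [IsFiniteMeasure (lebesgue Ω)]
    (μ : VectorMeasure Ω (EuclideanSpace ℝ (Fin m))) :
    ∃ N : Set Ω, MeasurableSet N ∧ lebesgue Ω N = 0 ∧
      ∀ t, MeasurableSet t → t ⊆ Nᶜ → singularPart μ t = 0 := by
  have hms : ∀ i, ∃ s : Set Ω, MeasurableSet s ∧
      (∀ t ⊆ s, (component i μ).singularPart (lebesgue Ω) t = 0) ∧ lebesgue Ω sᶜ = 0 := by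
    intro i
    obtain ⟨s, hs, h1, h2⟩ := SignedMeasure.mutuallySingular_singularPart (component i μ)
      (lebesgue Ω)
    refine ⟨s, hs, h1, ?_⟩
    have := h2 sᶜ subset_rfl
    rwa [Measure.toENNRealVectorMeasure_apply_measurable hs.compl] at this
  choose s hs h1 h2 using hms
  refine ⟨⋃ i, (s i)ᶜ, MeasurableSet.iUnion fun i => (hs i).compl, measure_iUnion_null h2,
    fun t ht htN => ?_⟩
  ext i
  rw [singularPart_apply μ ht, h1 i t, PiLp.zero_apply]
  intro x hx
  by_contra hxs
  exact htN hx (mem_iUnion.2 ⟨i, hxs⟩)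

end Decomposition

/-! ### The Huber norm as a supremum of weak* continuous functions -/

section Duality

variable {d m : ℕ} {Ω : Set (EuclideanSpace ℝ (Fin d))}

/-- The weight `1 / (2γ)` of the quadratic term in the dual formula for the Huber regularisation;
it is `0` for `γ = ∞`. -/
noncomputable def dualWeight (γ : ℝ≥0∞) : ℝ := γ⁻¹.toReal / 2

theorem dualWeight_nonneg (γ : ℝ≥0∞) : 0 ≤ dualWeight γ := by unfold dualWeight; positivity

@[simp] theorem dualWeight_top : dualWeight ⊤ = 0 := by simp [dualWeight]

theorem dualWeight_anti {γ γ' : ℝ≥0∞} (hγ : γ ≠ 0) (h : γ ≤ γ') :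
    dualWeight γ' ≤ dualWeight γ := by
  unfold dualWeight
  have := ENNReal.toReal_mono (ENNReal.inv_ne_top.2 hγ) (ENNReal.inv_le_inv.2 h)
  linarith

theorem continuousAt_dualWeight {γ : ℝ≥0∞} (hγ : γ ≠ 0) : ContinuousAt dualWeight γ := by
  have h := (ENNReal.tendsto_toReal (ENNReal.inv_ne_top.2 hγ)).comp (tendsto_inv_iff.2 tendsto_id)
  exact h.div_const 2

/-- The maximiser of `v ↦ ⟪v, h⟫ - ‖v‖² / (2γ)` over the unit ball. -/
noncomputable def huberDirection (γ : ℝ≥0∞) (h : EuclideanSpace ℝ (Fin m)) :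
    EuclideanSpace ℝ (Fin m) :=
  if γ = ⊤ ∨ 1 / γ.toReal ≤ ‖h‖ then ‖h‖⁻¹ • h else γ.toReal • h

theorem norm_huberDirection_le (γ : ℝ≥0∞) (h : EuclideanSpace ℝ (Fin m)) :
    ‖huberDirection γ h‖ ≤ 1 := by
  unfold huberDirection
  split_ifs with hc
  · rw [norm_smul, norm_inv, norm_norm]; exact inv_mul_le_one
  · push Not at hc
    rw [norm_smul, Real.norm_of_nonneg ENNReal.toReal_nonneg]
    rcases eq_or_ne γ.toReal 0 with h0 | h0
    · simp [h0]
    · have hpos : 0 < γ.toReal := lt_of_le_of_ne ENNReal.toReal_nonneg h0.symm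
      have := hc.2.le
      rwa [le_div_iff₀' hpos] at this

theorem measurable_huberDirection (γ : ℝ≥0∞) :
    Measurable (huberDirection γ : EuclideanSpace ℝ (Fin m) → EuclideanSpace ℝ (Fin m)) := by
  unfold huberDirection
  refine Measurable.ite ?_ (by fun_prop) (by fun_prop)
  by_cases h : γ = ⊤
  · simp [h]
  · simpa [h] using! measurableSet_le measurable_const measurable_norm

theorem inner_huberDirection {γ : ℝ≥0∞} (hγ : γ ≠ 0) (h : EuclideanSpace ℝ (Fin m)) :
    inner ℝ (huberDirection γ h) h - dualWeight γ * ‖huberDirection γ h‖ ^ 2 = huber γ h := by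
  have hn : inner ℝ (‖h‖⁻¹ • h) h = ‖h‖ := by
    rw [real_inner_smul_left, real_inner_self_eq_norm_sq]
    rcases eq_or_ne ‖h‖ 0 with h0 | h0
    · simp [h0]
    · field_simp
  unfold huberDirection huber
  by_cases ht : γ = ⊤
  · simp [ht, hn]
  have hpos : 0 < γ.toReal := ENNReal.toReal_pos hγ ht
  have hw : dualWeight γ = 1 / (2 * γ.toReal) := by
    rw [dualWeight, ENNReal.toReal_inv]; field_simp
  simp only [ht, false_or, if_false]
  split_ifs with hc
  · have h0 : ‖h‖ ≠ 0 := ((by positivity : 0 < 1 / γ.toReal).trans_le hc).ne'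
    have h1 : ‖‖h‖⁻¹ • h‖ = 1 := by rw [norm_smul, norm_inv, norm_norm, inv_mul_cancel₀ h0]
    rw [hn, h1, hw]; ring
  · rw [real_inner_smul_left, real_inner_self_eq_norm_sq, norm_smul, Real.norm_of_nonneg hpos.le,
      hw]
    field_simp
    ring

/-- The Fenchel–Young inequality for the Huber function; equality is `inner_huberDirection`. -/
theorem inner_sub_le_huber {γ : ℝ≥0∞} (hγ : γ ≠ 0) {v : EuclideanSpace ℝ (Fin m)} (hv : ‖v‖ ≤ 1)
    (h : EuclideanSpace ℝ (Fin m)) :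
    inner ℝ v h - dualWeight γ * ‖v‖ ^ 2 ≤ huber γ h := by
  have hi : inner ℝ v h ≤ ‖v‖ * ‖h‖ := real_inner_le_norm v h
  have hv0 := norm_nonneg v
  have hh0 := norm_nonneg h
  unfold huber
  by_cases ht : γ = ⊤
  · simp only [ht, if_true, dualWeight_top]
    nlinarith
  have hpos : 0 < γ.toReal := ENNReal.toReal_pos hγ ht
  have hw : dualWeight γ = 1 / (2 * γ.toReal) := by
    rw [dualWeight, ENNReal.toReal_inv]; field_simp
  rw [hw]
  simp only [ht, if_false]
  set c := γ.toReal
  split_ifs with hc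
  · have h1 : 1 / (2 * c) = (1 / c) / 2 := by field_simp
    rw [h1]
    have h2 : 0 ≤ 1 / c := by positivity
    nlinarith [mul_nonneg (sub_nonneg.2 hv) (sub_nonneg.2 hc), mul_nonneg (sub_nonneg.2 hv)
      (mul_nonneg h2 (sub_nonneg.2 hv))]
  · have h1 : ‖v‖ * ‖h‖ - 1 / (2 * c) * ‖v‖ ^ 2 - c / 2 * ‖h‖ ^ 2
        = -(1 / (2 * c) * (‖v‖ - c * ‖h‖) ^ 2) := by
      field_simp; ring
    have h2 : 0 ≤ 1 / (2 * c) * (‖v‖ - c * ‖h‖) ^ 2 := by positivity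
    linarith

theorem huber_nonneg {γ : ℝ≥0∞} (hγ : γ ≠ 0) (h : EuclideanSpace ℝ (Fin m)) : 0 ≤ huber γ h := by
  simpa using inner_sub_le_huber hγ (v := 0) (by simp) h

theorem huber_le_norm {γ : ℝ≥0∞} (hγ : γ ≠ 0) (h : EuclideanSpace ℝ (Fin m)) : huber γ h ≤ ‖h‖ := by
  rw [← inner_huberDirection hγ]
  have h1 : inner ℝ (huberDirection γ h) h ≤ ‖huberDirection γ h‖ * ‖h‖ := real_inner_le_norm _ h
  have h2 := mul_le_mul_of_nonneg_right (norm_huberDirection_le γ h) (norm_nonneg h)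
  have h3 := mul_nonneg (dualWeight_nonneg γ) (sq_nonneg ‖huberDirection γ h‖)
  linarith

theorem measurable_huber {γ : ℝ≥0∞} (hγ : γ ≠ 0) :
    Measurable (huber γ : EuclideanSpace ℝ (Fin m) → ℝ) := by
  have h := measurable_huberDirection (m := m) γ
  have : (huber γ : EuclideanSpace ℝ (Fin m) → ℝ) = fun h => inner ℝ (huberDirection γ h) h
      - dualWeight γ * ‖huberDirection γ h‖ ^ 2 := by
    ext1 x; exact (inner_huberDirection hγ x).symm
  rw [this]
  fun_prop

theorem integrable_huber_acDensity {γ : ℝ≥0∞} (hγ : γ ≠ 0)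
    (μ : VectorMeasure Ω (EuclideanSpace ℝ (Fin m))) :
    Integrable (fun x => huber γ (acDensity μ x)) (lebesgue Ω) := by
  refine (integrable_acDensity μ).mono
    ((measurable_huber hγ).comp (stronglyMeasurable_acDensity μ).measurable).aestronglyMeasurable
    (ae_of_all _ fun x => ?_)
  rw [Real.norm_of_nonneg (huber_nonneg hγ _)]
  exact huber_le_norm hγ _

/-- The dual objective: for `g` in the unit ball it is a lower bound of the Huber norm of `μ`. -/
noncomputable def dualObjective (γ : ℝ≥0∞) (μ : VectorMeasure Ω (EuclideanSpace ℝ (Fin m)))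
    (g : Ω → EuclideanSpace ℝ (Fin m)) : ℝ :=
  (∫ᵛ x, g x ∂[innerSL ℝ; μ]) - dualWeight γ * ∫ x, ‖g x‖ ^ 2 ∂lebesgue Ω

theorem integrable_of_norm_le_one {S E : Type*} [MeasurableSpace S] [NormedAddCommGroup E]
    {ν : Measure S} [IsFiniteMeasure ν] {g : S → E} (hg : StronglyMeasurable g)
    (hg1 : ∀ x, ‖g x‖ ≤ 1) : Integrable g ν :=
  Integrable.of_bound hg.aestronglyMeasurable 1 (ae_of_all _ hg1)

theorem integrable_norm_sq {S E : Type*} [MeasurableSpace S] [NormedAddCommGroup E]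
    {ν : Measure S} [IsFiniteMeasure ν] {g : S → E} (hg : StronglyMeasurable g)
    (hg1 : ∀ x, ‖g x‖ ≤ 1) : Integrable (fun x => ‖g x‖ ^ 2) ν := by
  refine Integrable.of_bound (hg.norm.pow 2).aestronglyMeasurable 1 (ae_of_all _ fun x => ?_)
  rw [norm_pow, norm_norm]
  exact pow_le_one₀ (norm_nonneg _) (hg1 x)

theorem integrable_inner_acDensity (μ : VectorMeasure Ω (EuclideanSpace ℝ (Fin m)))
    {g : Ω → EuclideanSpace ℝ (Fin m)} (hg : StronglyMeasurable g) (hg1 : ∀ x, ‖g x‖ ≤ 1) :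
    Integrable (fun x => inner ℝ (g x) (acDensity μ x) : Ω → ℝ) (lebesgue Ω) := by
  refine (integrable_acDensity μ).mono
    (hg.inner (stronglyMeasurable_acDensity μ)).aestronglyMeasurable (ae_of_all _ fun x => ?_)
  exact (norm_inner_le_norm _ _).trans (mul_le_of_le_one_left (norm_nonneg _) (hg1 x))

/-- The Lebesgue decomposition of the dual objective. -/
theorem dualObjective_eq [IsFiniteMeasure (lebesgue Ω)] {γ : ℝ≥0∞}
    {μ : VectorMeasure Ω (EuclideanSpace ℝ (Fin m))} (hμ : radonNorm μ ≠ ⊤)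
    {g : Ω → EuclideanSpace ℝ (Fin m)} (hg : StronglyMeasurable g) (hg1 : ∀ x, ‖g x‖ ≤ 1) :
    dualObjective γ μ g = (∫ᵛ x, g x ∂[innerSL ℝ; singularPart μ]) +
      ∫ x, (inner ℝ (g x) (acDensity μ x) - dualWeight γ * ‖g x‖ ^ 2) ∂lebesgue Ω := by
  have h1 := isFiniteMeasure_variation_singularPart hμ
  have h2 := isFiniteMeasure_variation_withDensityᵥ (integrable_acDensity μ)
  rw [integral_sub (integrable_inner_acDensity μ hg hg1)
    ((integrable_norm_sq hg hg1).const_mul _), integral_const_mul,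
    ← integral_withDensityᵥ_inner (integrable_acDensity μ) hg hg1, ← add_sub_assoc,
    ← VectorMeasure.integral_add_vectorMeasure, singularPart_add_withDensityᵥ, dualObjective]
  · exact integrable_of_norm_le_one hg hg1
  · exact integrable_of_norm_le_one hg hg1

theorem opNorm_innerSL_le_one {E : Type*} [NormedAddCommGroup E] [InnerProductSpace ℝ E] :
    ‖(innerSL ℝ : E →L[ℝ] E →L[ℝ] ℝ)‖ ≤ 1 :=
  ContinuousLinearMap.opNorm_le_bound _ zero_le_one fun x => by rw [innerSL_apply_norm, one_mul]

theorem integral_le_variation {S E : Type*} [MeasurableSpace S] [NormedAddCommGroup E]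
    [InnerProductSpace ℝ E] [CompleteSpace E] (σ : VectorMeasure S E)
    [IsFiniteMeasure σ.variation] {g : S → E} (hg1 : ∀ x, ‖g x‖ ≤ 1) :
    ∫ᵛ x, g x ∂[innerSL ℝ; σ] ≤ (σ.variation univ).toReal := by
  have h := VectorMeasure.norm_integral_le_of_norm_le_const (B := innerSL ℝ) (μ := σ)
    (ae_of_all _ hg1)
  have h2 : ‖(innerSL ℝ : E →L[ℝ] E →L[ℝ] ℝ)‖ ≤ 1 := opNorm_innerSL_le_one
  refine (le_abs_self _).trans (h.trans ?_)
  rw [one_mul]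
  exact mul_le_of_le_one_left ENNReal.toReal_nonneg h2

theorem dualObjective_le [IsFiniteMeasure (lebesgue Ω)] {γ : ℝ≥0∞} (hγ : γ ≠ 0)
    {μ : VectorMeasure Ω (EuclideanSpace ℝ (Fin m))} (hμ : radonNorm μ ≠ ⊤)
    {g : Ω → EuclideanSpace ℝ (Fin m)} (hg : StronglyMeasurable g) (hg1 : ∀ x, ‖g x‖ ≤ 1) :
    dualObjective γ μ g ≤ (∫ x, huber γ (acDensity μ x) ∂lebesgue Ω)
      + (radonNorm (singularPart μ)).toReal := by
  have h1 := isFiniteMeasure_variation_singularPart hμ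
  rw [dualObjective_eq hμ hg hg1, add_comm]
  refine add_le_add ?_ (integral_le_variation _ hg1)
  exact integral_mono ((integrable_inner_acDensity μ hg hg1).sub
    ((integrable_norm_sq hg hg1).const_mul _)) (integrable_huber_acDensity hγ μ)
    fun x => inner_sub_le_huber hγ (hg1 x) _

/-- The dual objective comes arbitrarily close to the Huber norm on measurable functions. For
`γ = ∞` the left side is the Radon norm. -/
theorem exists_dualObjective_ge [IsFiniteMeasure (lebesgue Ω)] {γ : ℝ≥0∞} (hγ : γ ≠ 0)
    {μ : VectorMeasure Ω (EuclideanSpace ℝ (Fin m))} (hμ : radonNorm μ ≠ ⊤) {ε : ℝ} (hε : 0 < ε) :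
    ∃ g : Ω → EuclideanSpace ℝ (Fin m), StronglyMeasurable g ∧ (∀ x, ‖g x‖ ≤ 1) ∧
      (∫ x, huber γ (acDensity μ x) ∂lebesgue Ω) + (radonNorm (singularPart μ)).toReal
        ≤ dualObjective γ μ g + ε := by
  have hfin := isFiniteMeasure_variation_singularPart hμ
  obtain ⟨N, hN, hN0, hNs⟩ := exists_null_carrier_singularPart μ
  obtain ⟨g₁, hg₁, hg₁1, hg₁0, hg₁e⟩ := exists_almost_norming (singularPart μ) hN hNs hε
  let k : Ω → EuclideanSpace ℝ (Fin m) := fun x => huberDirection γ (acDensity μ x)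
  have hk : StronglyMeasurable k :=
    ((measurable_huberDirection γ).comp
      (stronglyMeasurable_acDensity μ).measurable).stronglyMeasurable
  -- On the null set carrying the singular part follow its direction, elsewhere that of the density.
  let g : Ω → EuclideanSpace ℝ (Fin m) := fun x => g₁ x + Nᶜ.indicator k x
  have hgN : ∀ x ∈ N, g x = g₁ x := fun x hx => by simp [g, hx]
  have hgN' : ∀ x, x ∉ N → g x = k x := fun x hx => by simp [g, hx, hg₁0 x hx]
  have hg : StronglyMeasurable g := hg₁.add (hk.indicator hN.compl)
  have hg1 : ∀ x, ‖g x‖ ≤ 1 := by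
    intro x
    by_cases hx : x ∈ N
    · rw [hgN x hx]; exact hg₁1 x
    · rw [hgN' x hx]; exact norm_huberDirection_le _ _
  refine ⟨g, hg, hg1, ?_⟩
  rw [dualObjective_eq hμ hg hg1]
  have hs : ∫ᵛ x, g x ∂[innerSL ℝ; singularPart μ] = ∫ᵛ x, g₁ x ∂[innerSL ℝ; singularPart μ] := by
    refine VectorMeasure.integral_congr_ae ?_
    have : (singularPart μ).variation Nᶜ = 0 :=
      (VectorMeasure.variation_apply_eq_zero hN.compl).2 fun t h1 h2 => hNs t h2 h1
    filter_upwards [measure_eq_zero_iff_ae_notMem.1 this] with x hx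
    exact hgN x (by simpa using hx)
  have ha : ∫ x, (inner ℝ (g x) (acDensity μ x) - dualWeight γ * ‖g x‖ ^ 2) ∂lebesgue Ω
      = ∫ x, huber γ (acDensity μ x) ∂lebesgue Ω := by
    refine integral_congr_ae ?_
    filter_upwards [measure_eq_zero_iff_ae_notMem.1 hN0] with x hx
    rw [hgN' x hx]
    exact inner_huberDirection hγ _
  rw [hs, ha]
  unfold radonNorm
  linarith

/-- Almost optimal competitors in the dual formula can be taken in `C₀`. -/
theorem exists_zeroAtInfty_dualObjective_ge (hΩ : IsOpen Ω) (hΩb : Bornology.IsBounded Ω)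
    {γ : ℝ≥0∞} {μ : VectorMeasure Ω (EuclideanSpace ℝ (Fin m))} (hμ : radonNorm μ ≠ ⊤)
    {g : Ω → EuclideanSpace ℝ (Fin m)} (hg : StronglyMeasurable g) (hg1 : ∀ x, ‖g x‖ ≤ 1)
    {ε : ℝ} (hε : 0 < ε) :
    ∃ φ : C₀(Ω, EuclideanSpace ℝ (Fin m)), (∀ x, ‖φ x‖ ≤ 1) ∧
      dualObjective γ μ g ≤ dualObjective γ μ φ + ε := by
  have hfin := isFiniteMeasure_variation hμ
  have hleb := isFiniteMeasure_lebesgue hΩ hΩb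
  have hloc : LocallyCompactSpace Ω := hΩ.locallyCompactSpace
  let ν : Measure Ω := μ.variation + lebesgue Ω
  set D : ℝ := 1 + 2 * dualWeight γ with hD
  have hDpos : 0 < D := by have := dualWeight_nonneg γ; positivity
  obtain ⟨φ, hφ1, -, hφ⟩ := exists_zeroAtInfty_approx ν (integrable_of_norm_le_one hg hg1) hg1
    (div_pos hε hDpos)
  have hφm : StronglyMeasurable φ := φ.continuous.stronglyMeasurable
  refine ⟨φ, hφ1, ?_⟩
  have hdiff : ∀ (ρ : Measure Ω) [IsFiniteMeasure ρ], Integrable (fun x => ‖g x - φ x‖) ρ :=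
    fun ρ _ => ((integrable_of_norm_le_one hg hg1).sub
      (integrable_of_norm_le_one hφm hφ1)).norm
  rw [integral_add_measure (hdiff _) (hdiff _)] at hφ
  set a := ∫ x, ‖g x - φ x‖ ∂μ.variation
  set b := ∫ x, ‖g x - φ x‖ ∂lebesgue Ω
  have ha0 : 0 ≤ a := integral_nonneg fun x => norm_nonneg _
  have hb0 : 0 ≤ b := integral_nonneg fun x => norm_nonneg _
  have h1 : (∫ᵛ x, g x ∂[innerSL ℝ; μ]) - ∫ᵛ x, φ x ∂[innerSL ℝ; μ] ≤ a := by
    rw [← VectorMeasure.integral_fun_sub (integrable_of_norm_le_one hg hg1)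
      (integrable_of_norm_le_one hφm hφ1)]
    refine (Real.le_norm_self _).trans ((VectorMeasure.norm_integral_le_integral_norm).trans ?_)
    exact mul_le_of_le_one_left ha0 opNorm_innerSL_le_one
  have h2 : (∫ x, ‖φ x‖ ^ 2 ∂lebesgue Ω) - ∫ x, ‖g x‖ ^ 2 ∂lebesgue Ω ≤ 2 * b := by
    rw [← integral_sub (integrable_norm_sq hφm hφ1) (integrable_norm_sq hg hg1),
      ← integral_const_mul]
    refine integral_mono ((integrable_norm_sq hφm hφ1).sub (integrable_norm_sq hg hg1))
      ((hdiff _).const_mul 2) fun x => ?_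
    have h3 : ‖φ x‖ - ‖g x‖ ≤ ‖g x - φ x‖ := by
      rw [norm_sub_rev]; exact norm_sub_norm_le _ _
    have h4 := hφ1 x
    have h5 := hg1 x
    have h6 := norm_nonneg (φ x)
    have h7 := norm_nonneg (g x)
    have h8 := norm_nonneg (g x - φ x)
    simp only
    nlinarith
  have h3 : D * (a + b) ≤ ε := by rwa [le_div_iff₀' hDpos] at hφ
  have h4 := mul_le_mul_of_nonneg_left h2 (dualWeight_nonneg γ)
  have h5 := mul_nonneg (dualWeight_nonneg γ) ha0
  unfold dualObjective
  nlinarith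

theorem radonNorm_le_add (μ : VectorMeasure Ω (EuclideanSpace ℝ (Fin m))) :
    radonNorm μ ≤ (∫⁻ x, ENNReal.ofReal (huber ⊤ (acDensity μ x)) ∂lebesgue Ω)
      + radonNorm (singularPart μ) := by
  conv_lhs => rw [← singularPart_add_withDensityᵥ μ]
  unfold radonNorm
  refine (VectorMeasure.variation_add_le univ).trans ?_
  rw [Measure.add_apply, add_comm, Measure.variation_withDensityᵥ (integrable_acDensity μ),
    withDensity_apply _ MeasurableSet.univ, Measure.restrict_univ]
  simp [huber]

/-- Duality: the Huber norm is the supremum of the dual objective over the unit ball of `C₀`. -/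
theorem huberNorm_eq_iSup (hΩ : IsOpen Ω) (hΩb : Bornology.IsBounded Ω) {γ : ℝ≥0∞} (hγ : γ ≠ 0)
    {μ : VectorMeasure Ω (EuclideanSpace ℝ (Fin m))} (hμ : radonNorm μ ≠ ⊤) :
    huberNorm γ μ = ⨆ φ : {φ : C₀(Ω, EuclideanSpace ℝ (Fin m)) // ∀ x, ‖φ x‖ ≤ 1},
      ENNReal.ofReal (dualObjective γ μ φ) := by
  have hfin := isFiniteMeasure_variation hμ
  have hsing := isFiniteMeasure_variation_singularPart hμ
  have hleb := isFiniteMeasure_lebesgue hΩ hΩb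
  set I := ∫ x, huber γ (acDensity μ x) ∂lebesgue Ω with hI
  set R := (radonNorm (singularPart μ)).toReal with hR
  have hI0 : 0 ≤ I := integral_nonneg fun x => huber_nonneg hγ _
  have hval : (∫⁻ x, ENNReal.ofReal (huber γ (acDensity μ x)) ∂lebesgue Ω)
      + radonNorm (singularPart μ) = ENNReal.ofReal (I + R) := by
    rw [ENNReal.ofReal_add hI0 ENNReal.toReal_nonneg, hI,
      ofReal_integral_eq_lintegral_ofReal (integrable_huber_acDensity hγ μ)
        (ae_of_all _ fun x => huber_nonneg hγ _), ENNReal.ofReal_toReal]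
    exact (measure_lt_top (singularPart μ).variation univ).ne
  apply le_antisymm
  · have h1 : huberNorm γ μ ≤ ENNReal.ofReal (I + R) := by
      rw [← hval]
      unfold huberNorm
      split_ifs with ht
      · rw [ht]; exact radonNorm_le_add μ
      · exact le_rfl
    refine h1.trans (ENNReal.le_of_forall_pos_le_add fun ε hε _ => ?_)
    have hε' : (0 : ℝ) < ε / 2 := by positivity
    obtain ⟨g, hg, hg1, hge⟩ := exists_dualObjective_ge hγ hμ hε'
    obtain ⟨φ, hφ1, hφe⟩ := exists_zeroAtInfty_dualObjective_ge (γ := γ) hΩ hΩb hμ hg hg1 hε'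
    calc ENNReal.ofReal (I + R) ≤ ENNReal.ofReal (dualObjective γ μ φ + ε) :=
          ENNReal.ofReal_le_ofReal (by linarith)
      _ ≤ ENNReal.ofReal (dualObjective γ μ φ) + ENNReal.ofReal ε := ENNReal.ofReal_add_le
      _ ≤ _ := by
        rw [ENNReal.ofReal_coe_nnreal]
        gcongr
        exact le_iSup (fun φ : {φ : C₀(Ω, EuclideanSpace ℝ (Fin m)) // ∀ x, ‖φ x‖ ≤ 1} =>
          ENNReal.ofReal (dualObjective γ μ φ)) ⟨φ, hφ1⟩
  · refine iSup_le fun φ => ?_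
    have hφm : StronglyMeasurable φ.1 := φ.1.continuous.stronglyMeasurable
    unfold huberNorm
    split_ifs with ht
    · refine ENNReal.ofReal_le_of_le_toReal ?_
      have h1 := integral_le_variation μ φ.2
      simpa [dualObjective, ht] using! h1
    · rw [hval]
      exact ENNReal.ofReal_le_ofReal (dualObjective_le hγ hμ hφm φ.2)

end Duality

/-! ### Consequences of duality for the Huber norms -/

section HuberNorm

variable {d m : ℕ} {Ω : Set (EuclideanSpace ℝ (Fin d))}

@[simp] theorem huberNorm_top (μ : VectorMeasure Ω (EuclideanSpace ℝ (Fin m))) :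
    huberNorm ⊤ μ = radonNorm μ := by simp [huberNorm]

@[simp] theorem radonNorm_zero :
    radonNorm (0 : VectorMeasure Ω (EuclideanSpace ℝ (Fin m))) = 0 := by simp [radonNorm]

theorem integral_norm_sq_nonneg (g : Ω → EuclideanSpace ℝ (Fin m)) :
    0 ≤ ∫ x, ‖g x‖ ^ 2 ∂lebesgue Ω :=
  integral_nonneg fun _ => sq_nonneg _

theorem integral_norm_sq_le [IsFiniteMeasure (lebesgue Ω)]
    (φ : C₀(Ω, EuclideanSpace ℝ (Fin m))) (hφ : ∀ x, ‖φ x‖ ≤ 1) :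
    ∫ x, ‖φ x‖ ^ 2 ∂lebesgue Ω ≤ (lebesgue Ω univ).toReal := by
  have h := integral_mono (integrable_norm_sq (ν := lebesgue Ω) φ.continuous.stronglyMeasurable hφ)
    (integrable_const (1 : ℝ)) fun x => pow_le_one₀ (norm_nonneg _) (hφ x)
  simpa [Measure.real] using h

theorem huberNorm_mono (hΩ : IsOpen Ω) (hΩb : Bornology.IsBounded Ω)
    {γ γ' : ℝ≥0∞} (hγ : γ ≠ 0) (h : γ ≤ γ')
    {μ : VectorMeasure Ω (EuclideanSpace ℝ (Fin m))} (hμ : radonNorm μ ≠ ⊤) :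
    huberNorm γ μ ≤ huberNorm γ' μ := by
  rw [huberNorm_eq_iSup hΩ hΩb hγ hμ,
    huberNorm_eq_iSup hΩ hΩb (pos_iff_ne_zero.1 ((pos_iff_ne_zero.2 hγ).trans_le h)) hμ]
  refine iSup_mono fun φ => ENNReal.ofReal_le_ofReal ?_
  have := mul_le_mul_of_nonneg_right (dualWeight_anti hγ h) (integral_norm_sq_nonneg φ.1)
  unfold dualObjective
  linarith

theorem huberNorm_le_radonNorm (hΩ : IsOpen Ω) (hΩb : Bornology.IsBounded Ω)
    {γ : ℝ≥0∞} (hγ : γ ≠ 0)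
    {μ : VectorMeasure Ω (EuclideanSpace ℝ (Fin m))} (hμ : radonNorm μ ≠ ⊤) :
    huberNorm γ μ ≤ radonNorm μ := by
  simpa using huberNorm_mono hΩ hΩb hγ le_top hμ

/-- The Huber norm of a fixed measure depends continuously on `γ`, uniformly in the measure. -/
theorem huberNorm_le_add (hΩ : IsOpen Ω) (hΩb : Bornology.IsBounded Ω)
    {γ γ' : ℝ≥0∞} (hγ : γ ≠ 0) (hγ' : γ' ≠ 0)
    {μ : VectorMeasure Ω (EuclideanSpace ℝ (Fin m))} (hμ : radonNorm μ ≠ ⊤) :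
    huberNorm γ' μ ≤ huberNorm γ μ +
      ENNReal.ofReal (|dualWeight γ - dualWeight γ'| * (lebesgue Ω univ).toReal) := by
  have hleb := isFiniteMeasure_lebesgue hΩ hΩb
  rw [huberNorm_eq_iSup hΩ hΩb hγ' hμ, huberNorm_eq_iSup hΩ hΩb hγ hμ]
  refine iSup_le fun φ => ?_
  refine le_trans ?_ (add_le_add_left (le_iSup _ φ) _)
  refine le_trans (ENNReal.ofReal_le_ofReal ?_) ENNReal.ofReal_add_le
  have h1 := integral_norm_sq_le φ.1 φ.2
  have h2 := integral_norm_sq_nonneg φ.1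
  have h3 := mul_le_mul_of_nonneg_right (le_abs_self (dualWeight γ - dualWeight γ')) h2
  have h4 := mul_le_mul_of_nonneg_left h1 (abs_nonneg (dualWeight γ - dualWeight γ'))
  unfold dualObjective
  linarith

/-- The Huber norms are jointly lower semicontinuous with respect to `γ` and weak* convergence. -/
theorem eventually_lt_huberNorm (hΩ : IsOpen Ω) (hΩb : Bornology.IsBounded Ω)
    {I : Type*} {l : Filter I} {γ : I → ℝ≥0∞} {γ₀ : ℝ≥0∞}
    (hγ : Tendsto γ l (𝓝 γ₀)) (hγ₀ : γ₀ ≠ 0)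
    {μ : I → VectorMeasure Ω (EuclideanSpace ℝ (Fin m))}
    {μ₀ : VectorMeasure Ω (EuclideanSpace ℝ (Fin m))} (hμ : ∀ i, radonNorm (μ i) ≠ ⊤)
    (hμ₀ : radonNorm μ₀ ≠ ⊤)
    (hlim : ∀ φ : C₀(Ω, EuclideanSpace ℝ (Fin m)),
      Tendsto (fun i => ∫ᵛ x, φ x ∂[innerSL ℝ; μ i]) l (𝓝 (∫ᵛ x, φ x ∂[innerSL ℝ; μ₀])))
    {c : ℝ≥0∞} (hc : c < huberNorm γ₀ μ₀) : ∀ᶠ i in l, c < huberNorm (γ i) (μ i) := by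
  rw [huberNorm_eq_iSup hΩ hΩb hγ₀ hμ₀] at hc
  obtain ⟨φ, hφ⟩ := lt_iSup_iff.1 hc
  have ht : Tendsto (fun i => ENNReal.ofReal (dualObjective (γ i) (μ i) φ)) l
      (𝓝 (ENNReal.ofReal (dualObjective γ₀ μ₀ φ))) :=
    ENNReal.tendsto_ofReal ((hlim φ).sub
      (((continuousAt_dualWeight hγ₀).tendsto.comp hγ).mul_const _))
  filter_upwards [ht.eventually_const_lt hφ, hγ.eventually_ne hγ₀] with i hi hγi
  rw [huberNorm_eq_iSup hΩ hΩb hγi (hμ i)]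
  exact hi.trans_le
    (le_iSup (fun φ : {φ : C₀(Ω, EuclideanSpace ℝ (Fin m)) // ∀ x, ‖φ x‖ ≤ 1} =>
      ENNReal.ofReal (dualObjective (γ i) (μ i) φ)) φ)

theorem tendsto_huberNorm (hΩ : IsOpen Ω) (hΩb : Bornology.IsBounded Ω)
    {I : Type*} {l : Filter I} {γ : I → ℝ≥0∞} {γ₀ : ℝ≥0∞}
    (hγ : Tendsto γ l (𝓝 γ₀)) (hγ₀ : γ₀ ≠ 0)
    {μ : VectorMeasure Ω (EuclideanSpace ℝ (Fin m))} (hμ : radonNorm μ ≠ ⊤) :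
    Tendsto (fun i => huberNorm (γ i) μ) l (𝓝 (huberNorm γ₀ μ)) := by
  have ht : Tendsto (fun i => huberNorm γ₀ μ +
      ENNReal.ofReal (|dualWeight γ₀ - dualWeight (γ i)| * (lebesgue Ω univ).toReal)) l
      (𝓝 (huberNorm γ₀ μ)) := by
    have h1 : Tendsto (fun i => |dualWeight γ₀ - dualWeight (γ i)| * (lebesgue Ω univ).toReal) l
        (𝓝 0) := by
      have h2 := (((tendsto_const_nhds (x := dualWeight γ₀)).sub
        ((continuousAt_dualWeight hγ₀).tendsto.comp hγ)).abs.mul_const (lebesgue Ω univ).toReal)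
      simpa using! h2
    simpa using tendsto_const_nhds.add (ENNReal.tendsto_ofReal h1)
  refine tendsto_order.2 ⟨fun c hc => ?_, fun c hc => ?_⟩
  · exact eventually_lt_huberNorm hΩ hΩb hγ hγ₀ (fun _ => hμ) hμ (fun _ => tendsto_const_nhds) hc
  · filter_upwards [ht.eventually_lt_const hc, hγ.eventually_ne hγ₀] with i hi hγi
    exact (huberNorm_le_add hΩ hΩb hγ₀ hγi hμ).trans_lt hi

theorem huberNorm_convex (hΩ : IsOpen Ω) (hΩb : Bornology.IsBounded Ω)
    {γ : ℝ≥0∞} (hγ : γ ≠ 0)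
    {μ ν : VectorMeasure Ω (EuclideanSpace ℝ (Fin m))} (hμ : radonNorm μ ≠ ⊤)
    (hν : radonNorm ν ≠ ⊤) {a b : ℝ≥0} (hab : a + b = 1)
    (hμν : radonNorm ((a : ℝ) • μ + (b : ℝ) • ν) ≠ ⊤) :
    huberNorm γ ((a : ℝ) • μ + (b : ℝ) • ν) ≤ a * huberNorm γ μ + b * huberNorm γ ν := by
  have hμf := isFiniteMeasure_variation hμ
  have hνf := isFiniteMeasure_variation hν
  have hab' : (a : ℝ) + b = 1 := by exact_mod_cast hab
  rw [huberNorm_eq_iSup hΩ hΩb hγ hμν, huberNorm_eq_iSup hΩ hΩb hγ hμ,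
    huberNorm_eq_iSup hΩ hΩb hγ hν]
  refine iSup_le fun φ => ?_
  have hφ : ∀ σ : VectorMeasure Ω (EuclideanSpace ℝ (Fin m)), IsFiniteMeasure σ.variation →
      σ.Integrable φ.1 := fun σ _ =>
    integrable_of_norm_le_one φ.1.continuous.stronglyMeasurable φ.2
  have heq : dualObjective γ ((a : ℝ) • μ + (b : ℝ) • ν) φ
      = a * dualObjective γ μ φ + b * dualObjective γ ν φ := by
    unfold dualObjective
    rw [VectorMeasure.integral_add_vectorMeasure ((hφ μ hμf).smul_vectorMeasure _)
      ((hφ ν hνf).smul_vectorMeasure _), VectorMeasure.integral_smul_vectorMeasure,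
      VectorMeasure.integral_smul_vectorMeasure, smul_eq_mul, smul_eq_mul]
    linear_combination ((dualWeight γ * ∫ x, ‖φ.1 x‖ ^ 2 ∂lebesgue Ω)) * hab'
  calc ENNReal.ofReal (dualObjective γ ((a : ℝ) • μ + (b : ℝ) • ν) φ)
      ≤ ENNReal.ofReal (a * dualObjective γ μ φ) + ENNReal.ofReal (b * dualObjective γ ν φ) := by
        rw [heq]; exact ENNReal.ofReal_add_le
    _ = a * ENNReal.ofReal (dualObjective γ μ φ) + b * ENNReal.ofReal (dualObjective γ ν φ) := by
        rw [ENNReal.ofReal_mul a.coe_nonneg, ENNReal.ofReal_mul b.coe_nonneg]; simp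
    _ ≤ _ := by
        gcongr
        · exact le_iSup (fun φ : {φ : C₀(Ω, EuclideanSpace ℝ (Fin m)) // ∀ x, ‖φ x‖ ≤ 1} =>
            ENNReal.ofReal (dualObjective γ μ φ)) φ
        · exact le_iSup (fun φ : {φ : C₀(Ω, EuclideanSpace ℝ (Fin m)) // ∀ x, ‖φ x‖ ≤ 1} =>
            ENNReal.ofReal (dualObjective γ ν φ)) φ

theorem eq_zero_of_huber_eq_zero {γ : ℝ≥0∞} (hγ : γ ≠ 0) {h : EuclideanSpace ℝ (Fin m)}
    (hh : huber γ h = 0) : ‖h‖ = 0 := by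
  unfold huber at hh
  by_cases ht : γ = ⊤
  · simpa [ht] using hh
  have hpos : 0 < γ.toReal := ENNReal.toReal_pos hγ ht
  simp only [ht, if_false] at hh
  split_ifs at hh with hc
  · have h1 : 1 / (2 * γ.toReal) = (1 / γ.toReal) / 2 := by field_simp
    have h2 : 0 < 1 / γ.toReal := by positivity
    linarith
  · rcases mul_eq_zero.1 hh with h1 | h1
    · linarith
    · exact pow_eq_zero_iff two_ne_zero |>.1 h1

theorem radonNorm_eq_zero_of_huberNorm {γ : ℝ≥0∞} (hγ : γ ≠ 0)
    {μ : VectorMeasure Ω (EuclideanSpace ℝ (Fin m))} (h : huberNorm γ μ = 0) :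
    radonNorm μ = 0 := by
  by_cases ht : γ = ⊤
  · simpa [ht] using h
  rw [huberNorm, if_neg ht, add_eq_zero] at h
  have h1 : ∀ᵐ x ∂lebesgue Ω, ENNReal.ofReal (huber ⊤ (acDensity μ x)) = 0 := by
    have hm : Measurable fun x => ENNReal.ofReal (huber γ (acDensity μ x)) :=
      ((measurable_huber hγ).comp (stronglyMeasurable_acDensity μ).measurable).ennreal_ofReal
    filter_upwards [(lintegral_eq_zero_iff hm).1 h.1] with x hx
    have h2 := le_antisymm (ENNReal.ofReal_eq_zero.1 hx) (huber_nonneg hγ _)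
    simp [huber, eq_zero_of_huber_eq_zero hγ h2]
  have h3 := radonNorm_le_add μ
  rw [h.2, add_zero, lintegral_congr_ae h1] at h3
  simpa using h3

end HuberNorm

/-! ### Limits along ultrafilters -/

theorem exists_tendsto_ultrafilter {I T : Type*} [TopologicalSpace T] [CompactSpace T]
    (𝒰 : Ultrafilter I) (x : I → T) : ∃ y, Tendsto x 𝒰 (𝓝 y) :=
  ⟨_, (𝒰.map x).le_nhds_lim⟩

theorem le_of_tendsto_of_eventually_lt {I : Type*} {l : Filter I} [l.NeBot] {x : I → ℝ≥0∞}
    {a b : ℝ≥0∞} (hx : Tendsto x l (𝓝 b)) (h : ∀ c < a, ∀ᶠ i in l, c < x i) : a ≤ b :=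
  le_of_forall_lt_imp_le_of_dense fun c hc => ge_of_tendsto hx ((h c hc).mono fun _ hi => hi.le)

/-- The product on `[0, ∞]` is lower semicontinuous, also at `(0, ∞)` and `(∞, 0)` since it vanishes
there. -/
theorem mul_le_of_tendsto {I : Type*} {𝒰 : Ultrafilter I} {a x : I → ℝ≥0∞} {a₀ x₀ y : ℝ≥0∞}
    (ha : Tendsto a 𝒰 (𝓝 a₀)) (hx : ∀ c < x₀, ∀ᶠ i in 𝒰, c < x i)
    (hax : Tendsto (fun i => a i * x i) 𝒰 (𝓝 y)) : a₀ * x₀ ≤ y := by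
  rcases eq_or_ne a₀ 0 with h0 | h0
  · simp [h0]
  rcases eq_or_ne x₀ 0 with hx0 | hx0
  · simp [hx0]
  obtain ⟨x₁, hx₁⟩ := exists_tendsto_ultrafilter 𝒰 x
  have hle : x₀ ≤ x₁ := le_of_tendsto_of_eventually_lt hx₁ hx
  have hne : x₁ ≠ 0 := (pos_iff_ne_zero.1 ((pos_iff_ne_zero.2 hx0).trans_le hle))
  have := tendsto_nhds_unique hax (ENNReal.Tendsto.mul ha (Or.inl h0) hx₁ (Or.inl hne))
  rw [this]
  gcongr

theorem fidelity_eq_zero_iff {Y : Type*} [NormedAddCommGroup Y] {f v : Y} :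
    fidelity f v = 0 ↔ v = f := by
  rw [fidelity, ENNReal.ofReal_eq_zero]
  constructor
  · intro h
    have h1 : ‖f - v‖ = 0 := by
      have := sq_nonneg ‖f - v‖
      exact pow_eq_zero_iff two_ne_zero |>.1 (by linarith)
    exact (sub_eq_zero.1 (norm_eq_zero.1 h1)).symm
  · rintro rfl; simp

theorem fidelity_ne_top {Y : Type*} [NormedAddCommGroup Y] {f : Y} (v : Y) :
    fidelity f v ≠ ⊤ := ENNReal.ofReal_ne_top

section Stability

variable {d N : ℕ} {Ω : Set (EuclideanSpace ℝ (Fin d))} {m : Fin N → ℕ}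
variable {P X Y Z : Type*}
  [NormedAddCommGroup P] [NormedSpace ℝ P] [NormedAddCommGroup X] [NormedSpace ℝ X]
  [NormedAddCommGroup Y] [InnerProductSpace ℝ Y]
  [NormedAddCommGroup Z] [InnerProductSpace ℝ Z]
  {ι : X ≃L[ℝ] StrongDual ℝ P}
  {A : ∀ j, X →ₗ[ℝ] VectorMeasure Ω (EuclideanSpace ℝ (Fin (m j)))}
  {K : X →L[ℝ] Y} {Kdag : LinearMap.range K.toLinearMap →ₗ[ℝ] X} {K0 : X →L[ℝ] Z}
  {f : Y} {f0 : Z} {H : X → ℝ≥0∞}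

/-- The Banach–Alaoglu theorem, in terms of ultrafilters. -/
theorem exists_tendsto_weakStar (ι : X ≃L[ℝ] StrongDual ℝ P) {I : Type*} (𝒰 : Ultrafilter I)
    {u : I → X} {C : ℝ} (hu : ∀ᶠ i in 𝒰, ‖u i‖ ≤ C) :
    ∃ û, Tendsto u 𝒰 (@nhds X (weakStar ι) û) := by
  let v : I → WeakDual ℝ P := fun i => StrongDual.toWeakDual (ι (u i))
  have hcomp := WeakDual.isCompact_closedBall (𝕜 := ℝ) (E := P) 0
    (‖(ι : X →L[ℝ] StrongDual ℝ P)‖ * C)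
  have hv : ((𝒰.map v : Ultrafilter (WeakDual ℝ P)) : Filter (WeakDual ℝ P)) ≤
      𝓟 (WeakDual.toStrongDual ⁻¹'
        Metric.closedBall (0 : StrongDual ℝ P) (‖(ι : X →L[ℝ] StrongDual ℝ P)‖ * C)) := by
    rw [le_principal_iff]
    refine hu.mono fun i hi => ?_
    simp only [mem_preimage, mem_closedBall_zero_iff]
    exact ((ι : X →L[ℝ] StrongDual ℝ P).le_opNorm (u i)).trans
      (mul_le_mul_of_nonneg_left hi (norm_nonneg _))
  obtain ⟨x, -, hx⟩ := isCompact_iff_ultrafilter_le_nhds.1 hcomp _ hv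
  refine ⟨ι.symm (WeakDual.toStrongDual x), ?_⟩
  rw [nhds_induced, tendsto_comap_iff, ContinuousLinearEquiv.apply_symm_apply]
  exact hx

theorem radonNorm_ne_top (hKA : AssumptionKA ι A K Kdag) (j : Fin N) (u : X) :
    radonNorm (A j u) ≠ ⊤ := by
  obtain ⟨C, hC⟩ := hKA.bounded j
  exact ((hC u).trans_lt (ENNReal.mul_lt_top ENNReal.coe_lt_top enorm_lt_top)).ne

theorem huberNorm_ne_top (hΩ : IsOpen Ω) (hΩb : Bornology.IsBounded Ω)
    (hKA : AssumptionKA ι A K Kdag) {γ : ℝ≥0∞} (hγ : γ ≠ 0) (j : Fin N) (u : X) :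
    huberNorm γ (A j u) ≠ ⊤ :=
  ((huberNorm_le_radonNorm hΩ hΩb hγ (radonNorm_ne_top hKA j u)).trans_lt
    (radonNorm_ne_top hKA j u).lt_top).ne

theorem tendsto_inner_weakStar (hKA : AssumptionKA ι A K Kdag) {I : Type*} {l : Filter I}
    {u : I → X} {û : X} (hu : Tendsto u l (@nhds X (weakStar ι) û)) (y : Y) :
    Tendsto (fun i => inner ℝ y (K (u i))) l (𝓝 (inner ℝ y (K û))) :=
  (@Continuous.tendsto X ℝ (weakStar ι) _ _ (hKA.weakStar_K y) û).comp hu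

/-- The Huber norms of `A_j u` are jointly lower semicontinuous in `γ` and, weakly*, in `u`. -/
theorem eventually_lt_huberNorm_weakStar (hΩ : IsOpen Ω) (hΩb : Bornology.IsBounded Ω)
    (hKA : AssumptionKA ι A K Kdag) {I : Type*} {l : Filter I}
    {u : I → X} {û : X} (hu : Tendsto u l (@nhds X (weakStar ι) û))
    {γ : I → ℝ≥0∞} {γ₀ : ℝ≥0∞} (hγ : Tendsto γ l (𝓝 γ₀)) (hγ₀ : γ₀ ≠ 0) (j : Fin N)
    {c : ℝ≥0∞} (hc : c < huberNorm γ₀ (A j û)) : ∀ᶠ i in l, c < huberNorm (γ i) (A j (u i)) :=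
  eventually_lt_huberNorm hΩ hΩb hγ hγ₀ (fun _ => radonNorm_ne_top hKA j _)
    (radonNorm_ne_top hKA j _)
    (fun φ => (@Continuous.tendsto X ℝ (weakStar ι) _ _ (hKA.weakStar_A j φ) û).comp hu) hc

theorem eventually_lt_smoothing (hH : IsSmoothing ι H) {I : Type*} {l : Filter I}
    {u : I → X} {û : X} (hu : Tendsto u l (@nhds X (weakStar ι) û)) {c : ℝ≥0∞} (hc : c < H û) :
    ∀ᶠ i in l, c < H (u i) :=
  hu (hH.lsc û c hc)

/-! ### The inner objective -/

theorem reg_zero (γ : ℝ≥0∞) (hγ : γ ≠ 0) (hΩ : IsOpen Ω) (hΩb : Bornology.IsBounded Ω)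
    (α : Fin N → ℝ≥0∞) : reg A γ α 0 = 0 := by
  refine Finset.sum_eq_zero fun j _ => ?_
  have h := huberNorm_le_radonNorm hΩ hΩb hγ
    (μ := (0 : VectorMeasure Ω (EuclideanSpace ℝ (Fin (m j))))) (by simp)
  rw [radonNorm_zero, nonpos_iff_eq_zero] at h
  rw [map_zero, h, mul_zero]

theorem objective_zero_ne_top (hΩ : IsOpen Ω) (hΩb : Bornology.IsBounded Ω) {γ : ℝ≥0∞}
    (hγ : γ ≠ 0) {ε : ℝ≥0} (hε : (ε : ℝ≥0∞) * H 0 ≠ ⊤) (α : Fin N → ℝ≥0∞) :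
    objective A K f H γ ε α 0 ≠ ⊤ := by
  rw [objective, reg_zero γ hγ hΩ hΩb, add_zero]
  exact ENNReal.add_ne_top.2 ⟨hε, fidelity_ne_top _⟩

theorem objective_ne_top_of_mem (hΩ : IsOpen Ω) (hΩb : Bornology.IsBounded Ω) {γ : ℝ≥0∞}
    (hγ : γ ≠ 0) {ε : ℝ≥0} (hε : (ε : ℝ≥0∞) * H 0 ≠ ⊤) {α : Fin N → ℝ≥0∞} {u : X}
    (hu : u ∈ reconstructions A K f H γ ε α) : objective A K f H γ ε α u ≠ ⊤ :=
  ((hu.2 0).trans_lt (objective_zero_ne_top hΩ hΩb hγ hε α).lt_top).ne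

/-- The weak lower semicontinuity of the fidelity, in the sense of limits. -/
theorem fidelity_le_of_tendsto {I : Type*} {l : Filter I} [l.NeBot] {v : I → Y} {v₀ : Y}
    (hv : ∀ y, Tendsto (fun i => inner ℝ y (v i)) l (𝓝 (inner ℝ y v₀))) {a : ℝ≥0∞}
    (ha : Tendsto (fun i => fidelity f (v i)) l (𝓝 a)) : fidelity f v₀ ≤ a := by
  have h1 : Tendsto (fun i => ENNReal.ofReal (inner ℝ (f - v₀) (f - v i) - 1 / 2 * ‖f - v₀‖ ^ 2)) l
      (𝓝 (fidelity f v₀)) := by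
    have h2 : fidelity f v₀
        = ENNReal.ofReal (inner ℝ (f - v₀) (f - v₀) - 1 / 2 * ‖f - v₀‖ ^ 2) := by
      rw [fidelity, real_inner_self_eq_norm_sq]; congr 1; ring
    rw [h2]
    refine ENNReal.tendsto_ofReal (Tendsto.sub_const ?_ _)
    simp only [inner_sub_right]
    exact tendsto_const_nhds.sub (hv _)
  refine le_of_tendsto_of_tendsto h1 ha (Eventually.of_forall fun i => ENNReal.ofReal_le_ofReal ?_)
  have h3 := norm_sub_sq_real (f - v₀) (f - v i)
  have h4 := sq_nonneg ‖(f - v₀) - (f - v i)‖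
  linarith

/-- Weak convergence together with convergence of the fidelity is strong convergence. -/
theorem tendsto_of_tendsto_fidelity {I : Type*} {l : Filter I} {v : I → Y} {v₀ : Y}
    (hv : ∀ y, Tendsto (fun i => inner ℝ y (v i)) l (𝓝 (inner ℝ y v₀)))
    (ha : Tendsto (fun i => fidelity f (v i)) l (𝓝 (fidelity f v₀))) : Tendsto v l (𝓝 v₀) := by
  have h1 : Tendsto (fun i => 1 / 2 * ‖f - v i‖ ^ 2) l (𝓝 (1 / 2 * ‖f - v₀‖ ^ 2)) := by
    have h2 := (ENNReal.tendsto_toReal (fidelity_ne_top (f := f) v₀)).comp ha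
    have h3 : ∀ w : Y, (fidelity f w).toReal = 1 / 2 * ‖f - w‖ ^ 2 := fun w =>
      ENNReal.toReal_ofReal (by positivity)
    simpa only [Function.comp_def, h3] using h2
  have h2 : Tendsto (fun i => ‖v i - v₀‖ ^ 2) l (𝓝 0) := by
    have h3 : ∀ i, ‖v i - v₀‖ ^ 2 = 2 * (1 / 2 * ‖f - v i‖ ^ 2)
        - 2 * (inner ℝ (f - v₀) f - inner ℝ (f - v₀) (v i)) + ‖f - v₀‖ ^ 2 := by
      intro i
      have h4 := norm_sub_sq_real (f - v₀) (f - v i)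
      rw [sub_sub_sub_cancel_left, inner_sub_right] at h4
      linarith
    simp only [h3]
    have h5 := (((h1.const_mul 2).sub (((tendsto_const_nhds (x := inner ℝ (f - v₀) f)).sub
      (hv (f - v₀))).const_mul 2)).add_const (‖f - v₀‖ ^ 2))
    refine h5.trans (le_of_eq ?_)
    congr 1
    rw [← inner_sub_right, real_inner_self_eq_norm_sq]; ring
  rw [tendsto_iff_norm_sub_tendsto_zero]
  have h3 := (Real.continuous_sqrt.tendsto 0).comp h2
  simpa [Function.comp_def, Real.sqrt_sq (norm_nonneg _)] using h3

/-- Bounded objective values bound the minimisers, uniformly while `γ` and all weights stay away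
from zero. -/
theorem eventually_norm_le (hΩ : IsOpen Ω) (hΩb : Bornology.IsBounded Ω)
    (hKA : AssumptionKA ι A K Kdag) {I : Type*} {l : Filter I} {γ : I → ℝ≥0∞} {ε : I → ℝ≥0}
    {α : I → Fin N → ℝ≥0∞} {u : I → X} {γ₁ c a : ℝ≥0∞} (hγ₁ : γ₁ ≠ 0) (hc : c ≠ ⊤) (ha : a ≠ 0)
    (hγ : ∀ᶠ i in l, γ₁ ≤ γ i) (hα : ∀ᶠ i in l, ∀ j, a ≤ α i j)
    (hu : ∀ᶠ i in l, objective A K f H (γ i) (ε i) (α i) (u i) ≤ c) :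
    ∃ C : ℝ, ∀ᶠ i in l, ‖u i‖ ≤ C := by
  obtain ⟨C, hC⟩ := hKA.norm_equiv
  set b : ℝ≥0∞ := ENNReal.ofReal (|dualWeight γ₁ - dualWeight ⊤| * (lebesgue Ω univ).toReal)
  set κ : ℝ := ‖f‖ + (1 + 2 * c.toReal)
  set B : ℝ≥0∞ := C * (∑ _j : Fin N, (c / a + b) + ENNReal.ofReal κ) with hB
  have hBtop : B ≠ ⊤ := by
    refine ENNReal.mul_ne_top ENNReal.coe_ne_top (ENNReal.add_ne_top.2 ⟨?_, ENNReal.ofReal_ne_top⟩)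
    exact ENNReal.sum_ne_top.2 fun j _ =>
      ENNReal.add_ne_top.2 ⟨ENNReal.div_ne_top hc ha, ENNReal.ofReal_ne_top⟩
  refine ⟨B.toReal, ?_⟩
  filter_upwards [hγ, hα, hu] with i hγi hαi hui
  have hA : ∀ j, radonNorm (A j (u i)) ≤ c / a + b := by
    intro j
    have h0 := radonNorm_ne_top hKA j (u i)
    have h1 := huberNorm_le_add hΩ hΩb hγ₁ ENNReal.top_ne_zero h0
    rw [huberNorm_top] at h1
    refine h1.trans (add_le_add_left ?_ _)
    refine (huberNorm_mono hΩ hΩb hγ₁ hγi h0).trans ?_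
    rw [ENNReal.le_div_iff_mul_le (Or.inl ha) (Or.inr hc)]
    calc huberNorm (γ i) (A j (u i)) * a ≤ α i j * huberNorm (γ i) (A j (u i)) := by
          rw [mul_comm]; gcongr; exact hαi j
      _ ≤ reg A (γ i) (α i) (u i) :=
          Finset.single_le_sum (f := fun j => α i j * huberNorm (γ i) (A j (u i)))
            (fun _ _ => zero_le) (Finset.mem_univ j)
      _ ≤ c := le_trans le_add_self hui
  have hK : ‖K (u i)‖ₑ ≤ ENNReal.ofReal κ := by
    have h1 : fidelity f (K (u i)) ≤ c := le_trans (le_trans le_add_self le_self_add) hui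
    have h2 : 1 / 2 * ‖f - K (u i)‖ ^ 2 ≤ c.toReal :=
      (ENNReal.ofReal_le_iff_le_toReal hc).1 h1
    have h3 : ‖f - K (u i)‖ ≤ 1 + 2 * c.toReal := by nlinarith [norm_nonneg (f - K (u i))]
    have h4 : ‖K (u i)‖ ≤ κ := by
      have := norm_sub_norm_le (K (u i)) f
      rw [norm_sub_rev] at this
      simp only [κ]; linarith
    rw [← ofReal_norm]
    exact ENNReal.ofReal_le_ofReal h4
  have h5 : ‖u i‖ₑ ≤ B := by
    refine (hC (u i)).trans ?_
    rw [hB]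
    gcongr with j
    exact hA j
  rw [← toReal_enorm]
  exact ENNReal.toReal_mono hBtop h5

end Stability

/-! ### Existence, uniqueness and stability of solutions of the inner problem -/

section Stability

variable {d N : ℕ} {Ω : Set (EuclideanSpace ℝ (Fin d))} {m : Fin N → ℕ}
variable {P X Y Z : Type*}
  [NormedAddCommGroup P] [NormedSpace ℝ P] [NormedAddCommGroup X] [NormedSpace ℝ X]
  [NormedAddCommGroup Y] [InnerProductSpace ℝ Y]
  [NormedAddCommGroup Z] [InnerProductSpace ℝ Z]
  {ι : X ≃L[ℝ] StrongDual ℝ P}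
  {A : ∀ j, X →ₗ[ℝ] VectorMeasure Ω (EuclideanSpace ℝ (Fin (m j)))}
  {K : X →L[ℝ] Y} {Kdag : LinearMap.range K.toLinearMap →ₗ[ℝ] X} {K0 : X →L[ℝ] Z}
  {f : Y} {f0 : Z} {H : X → ℝ≥0∞}

/-- If the values at `u i` are asymptotically at most the minimum of the limit problem, then along
an ultrafilter the `u i` have a weak* limit that solves the limit problem, and `K (u i)` converges
in norm. -/
theorem exists_limit_reconstruction (hΩ : IsOpen Ω) (hΩb : Bornology.IsBounded Ω)
    (hKA : AssumptionKA ι A K Kdag) (hH : IsSmoothing ι H) {I : Type*} {𝒰 : Ultrafilter I}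
    {γ : I → ℝ≥0∞} {ε : I → ℝ≥0} {α : I → Fin N → ℝ≥0∞} {u : I → X} {γ₀ : ℝ≥0∞} {ε₀ : ℝ≥0}
    {α₀ : Fin N → ℝ≥0∞} (hγ : Tendsto γ 𝒰 (𝓝 γ₀)) (hε : Tendsto ε 𝒰 (𝓝 ε₀))
    (hα : Tendsto α 𝒰 (𝓝 α₀)) (hγ₀ : γ₀ ≠ 0) (hα₀ : ∀ j, α₀ j ≠ 0)
    (hε₀ : (ε₀ : ℝ≥0∞) * H 0 ≠ ⊤)
    (hu : ∀ w c, objective A K f H γ₀ ε₀ α₀ w < c →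
      ∀ᶠ i in 𝒰, objective A K f H (γ i) (ε i) (α i) (u i) < c) :
    ∃ û ∈ reconstructions A K f H γ₀ ε₀ α₀, Tendsto (fun i => K (u i)) 𝒰 (𝓝 (K û)) := by
  have hJ0 := objective_zero_ne_top (A := A) (K := K) (f := f) hΩ hΩb hγ₀ hε₀ α₀
  -- The `u i` are eventually bounded.
  obtain ⟨C, hC⟩ : ∃ C : ℝ, ∀ᶠ i in 𝒰, ‖u i‖ ≤ C := by
    obtain ⟨γ₁, hγ₁, hγ₁'⟩ := exists_between (pos_iff_ne_zero.2 hγ₀)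
    obtain ⟨a, ha, ha'⟩ : ∃ a : ℝ≥0∞, 0 < a ∧ ∀ j, a < α₀ j := by
      have : 0 < Finset.univ.inf (fun j => α₀ j) ⊓ ⊤ :=
        lt_inf_iff.2 ⟨(Finset.lt_inf_iff ENNReal.zero_lt_top).2
          fun j _ => pos_iff_ne_zero.2 (hα₀ j), ENNReal.zero_lt_top⟩
      obtain ⟨a, h1, h2⟩ := exists_between this
      exact ⟨a, h1, fun j => (h2.trans_le inf_le_left).trans_le (Finset.inf_le (Finset.mem_univ j))⟩
    refine eventually_norm_le hΩ hΩb hKA hγ₁.ne' (ENNReal.add_ne_top.2 ⟨hJ0, ENNReal.one_ne_top⟩)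
      ha.ne' ((hγ.eventually_const_lt hγ₁').mono fun i hi => hi.le) ?_
      ((hu 0 _ (ENNReal.lt_add_right hJ0 one_ne_zero)).mono fun i hi => hi.le)
    exact eventually_all.2 fun j =>
      (((tendsto_pi_nhds.1 hα) j).eventually_const_lt (ha' j)).mono fun i hi => hi.le
  obtain ⟨û, hû⟩ := exists_tendsto_weakStar ι 𝒰 hC
  -- In the compact space `[0, ∞]` all terms of the objective converge along the ultrafilter.
  obtain ⟨h₁, hh₁⟩ := exists_tendsto_ultrafilter 𝒰 fun i => (ε i : ℝ≥0∞) * H (u i)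
  obtain ⟨a₁, ha₁⟩ := exists_tendsto_ultrafilter 𝒰 fun i => fidelity f (K (u i))
  have hr : ∀ j, ∃ r, Tendsto (fun i => α i j * huberNorm (γ i) (A j (u i))) 𝒰 (𝓝 r) :=
    fun j => exists_tendsto_ultrafilter 𝒰 _
  choose r hr using hr
  have hT : Tendsto (fun i => objective A K f H (γ i) (ε i) (α i) (u i)) 𝒰
      (𝓝 (h₁ + a₁ + ∑ j, r j)) :=
    (hh₁.add ha₁).add (tendsto_finsetSum _ fun j _ => hr j)
  have hinner := tendsto_inner_weakStar hKA hû
  have hh : (ε₀ : ℝ≥0∞) * H û ≤ h₁ :=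
    mul_le_of_tendsto (ENNReal.tendsto_coe.2 hε) (fun c hc => eventually_lt_smoothing hH hû hc) hh₁
  have ha : fidelity f (K û) ≤ a₁ := fidelity_le_of_tendsto hinner ha₁
  have hrj : reg A γ₀ α₀ û ≤ ∑ j, r j := Finset.sum_le_sum fun j _ =>
    mul_le_of_tendsto ((tendsto_pi_nhds.1 hα) j)
      (fun c hc => eventually_lt_huberNorm_weakStar hΩ hΩb hKA hû hγ hγ₀ j hc) (hr j)
  have hle : ∀ w, h₁ + a₁ + ∑ j, r j ≤ objective A K f H γ₀ ε₀ α₀ w := fun w =>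
    le_of_forall_gt_imp_ge_of_dense fun c hc =>
      le_of_tendsto hT ((hu w c hc).mono fun i hi => hi.le)
  have hge : objective A K f H γ₀ ε₀ α₀ û ≤ h₁ + a₁ + ∑ j, r j := by
    unfold objective; gcongr
  have hmin : ∀ w, objective A K f H γ₀ ε₀ α₀ û ≤ objective A K f H γ₀ ε₀ α₀ w := fun w =>
    hge.trans (hle w)
  have hJ : objective A K f H γ₀ ε₀ α₀ û ≠ ⊤ := ((hmin 0).trans_lt hJ0.lt_top).ne
  have hparts := ENNReal.add_ne_top.1 hJ
  refine ⟨û, ⟨(ENNReal.add_ne_top.1 hparts.1).1, hmin⟩,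
    tendsto_of_tendsto_fidelity (f := f) hinner ?_⟩
  -- Each term is lower semicontinuous and the sum converges, so the fidelity converges.
  have haeq : a₁ ≤ fidelity f (K û) := by
    have h1 := hle û
    have h2 : (ε₀ : ℝ≥0∞) * H û + a₁ + reg A γ₀ α₀ û ≤ objective A K f H γ₀ ε₀ α₀ û :=
      le_trans (by gcongr) h1
    exact ENNReal.le_of_add_le_add_left (ENNReal.add_ne_top.1 hparts.1).1
      (ENNReal.le_of_add_le_add_right hparts.2 h2)
  rw [← le_antisymm haeq ha]
  exact ha₁

theorem nonempty_reconstructions (hΩ : IsOpen Ω) (hΩb : Bornology.IsBounded Ω)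
    (hKA : AssumptionKA ι A K Kdag) (hH : IsSmoothing ι H) (f : Y) {γ : ℝ≥0∞} {ε : ℝ≥0}
    {α : Fin N → ℝ≥0∞} (hγ : γ ≠ 0) (hα : ∀ j, α j ≠ 0) (hε : (ε : ℝ≥0∞) * H 0 ≠ ⊤) :
    (reconstructions A K f H γ ε α).Nonempty := by
  obtain ⟨x, -, hx, hxm⟩ := exists_seq_tendsto_sInf (range_nonempty (objective A K f H γ ε α))
    (OrderBot.bddBelow _)
  choose u hu using hxm
  obtain ⟨û, hû, -⟩ := exists_limit_reconstruction (𝒰 := hyperfilter ℕ) (γ := fun _ => γ)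
    (ε := fun _ => ε) (α := fun _ => α) (u := u) (f := f) hΩ hΩb hKA hH tendsto_const_nhds
    tendsto_const_nhds tendsto_const_nhds hγ hα hε fun w c hc => by
      have h1 : sInf (range (objective A K f H γ ε α)) < c :=
        (sInf_le (mem_range_self w)).trans_lt hc
      refine (hx.mono_left Nat.hyperfilter_le_atTop).eventually_lt_const h1 |>.mono fun i hi => ?_
      rwa [hu i]
  exact ⟨û, hû⟩

theorem reg_convex (hΩ : IsOpen Ω) (hΩb : Bornology.IsBounded Ω) (hKA : AssumptionKA ι A K Kdag)
    {γ : ℝ≥0∞} (hγ : γ ≠ 0) (α : Fin N → ℝ≥0∞) (u v : X) {a b : ℝ≥0} (hab : a + b = 1) :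
    reg A γ α (a • u + b • v) ≤ a * reg A γ α u + b * reg A γ α v := by
  unfold reg
  rw [Finset.mul_sum, Finset.mul_sum, ← Finset.sum_add_distrib]
  refine Finset.sum_le_sum fun j _ => ?_
  have hlin : A j (a • u + b • v) = (a : ℝ) • A j u + (b : ℝ) • A j v := by
    rw [NNReal.smul_def, NNReal.smul_def, map_add, map_smul, map_smul]
  have h := huberNorm_convex hΩ hΩb hγ (radonNorm_ne_top hKA j u) (radonNorm_ne_top hKA j v) hab
    (hlin ▸ radonNorm_ne_top hKA j (a • u + b • v))
  rw [hlin]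
  calc α j * huberNorm γ ((a : ℝ) • A j u + (b : ℝ) • A j v)
      ≤ α j * (a * huberNorm γ (A j u) + b * huberNorm γ (A j v)) := by gcongr
    _ = _ := by ring

/-- Solutions of the inner problem have the same image under `K`, by strict convexity of the
fidelity. -/
theorem K_eq_of_mem_reconstructions (hΩ : IsOpen Ω) (hΩb : Bornology.IsBounded Ω)
    (hKA : AssumptionKA ι A K Kdag) (hH : IsSmoothing ι H) {γ : ℝ≥0∞} {ε : ℝ≥0}
    {α : Fin N → ℝ≥0∞} (hγ : γ ≠ 0) (hε : (ε : ℝ≥0∞) * H 0 ≠ ⊤) {u v : X}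
    (hu : u ∈ reconstructions A K f H γ ε α) (hv : v ∈ reconstructions A K f H γ ε α) :
    K u = K v := by
  set J := objective A K f H γ ε α
  have hab : (1 / 2 : ℝ≥0) + 1 / 2 = 1 := add_halves 1
  set w : X := (1 / 2 : ℝ≥0) • u + (1 / 2 : ℝ≥0) • v with hw
  have hJu : J u ≠ ⊤ := objective_ne_top_of_mem hΩ hΩb hγ hε hu
  have hJv : J v = J u := le_antisymm (hv.2 u) (hu.2 v)
  have hhalf : ((1 / 2 : ℝ≥0) : ℝ≥0∞) + ((1 / 2 : ℝ≥0) : ℝ≥0∞) = 1 := by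
    rw [← ENNReal.coe_add, hab, ENNReal.coe_one]
  have hfid : fidelity f (K w) + ENNReal.ofReal (1 / 8 * ‖K u - K v‖ ^ 2)
      = ((1 / 2 : ℝ≥0) : ℝ≥0∞) * fidelity f (K u) + ((1 / 2 : ℝ≥0) : ℝ≥0∞) * fidelity f (K v) := by
    have hc : ((1 / 2 : ℝ≥0) : ℝ≥0∞) = ENNReal.ofReal (1 / 2) := by
      rw [← ENNReal.ofReal_coe_nnreal]; simp
    rw [hc, fidelity, fidelity, fidelity, ← ENNReal.ofReal_mul (by norm_num),
      ← ENNReal.ofReal_mul (by norm_num), ← ENNReal.ofReal_add (by positivity) (by positivity),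
      ← ENNReal.ofReal_add (by positivity) (by positivity)]
    congr 1
    have hKw : f - K w = (1 / 2 : ℝ) • ((f - K u) + (f - K v)) := by
      rw [hw, NNReal.smul_def, NNReal.smul_def, map_add, map_smul, map_smul]
      push_cast
      module
    have hKuv : K u - K v = (f - K v) - (f - K u) := by abel
    rw [hKw, hKuv]
    generalize f - K u = a
    generalize f - K v = b
    rw [norm_smul, mul_pow, norm_add_sq_real, norm_sub_sq_real, real_inner_comm a b]
    norm_num
    ring
  have hsum : J w + ENNReal.ofReal (1 / 8 * ‖K u - K v‖ ^ 2) ≤ J u := by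
    have h1 := hH.convex u v (1 / 2) (1 / 2) hab
    have h2 := reg_convex hΩ hΩb hKA hγ α u v hab
    calc J w + ENNReal.ofReal (1 / 8 * ‖K u - K v‖ ^ 2)
        = ε * H w + (fidelity f (K w) + ENNReal.ofReal (1 / 8 * ‖K u - K v‖ ^ 2))
          + reg A γ α w := by simp only [J, objective]; ring
      _ ≤ ε * (((1 / 2 : ℝ≥0) : ℝ≥0∞) * H u + ((1 / 2 : ℝ≥0) : ℝ≥0∞) * H v)
          + (((1 / 2 : ℝ≥0) : ℝ≥0∞) * fidelity f (K u) + ((1 / 2 : ℝ≥0) : ℝ≥0∞) * fidelity f (K v))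
          + (((1 / 2 : ℝ≥0) : ℝ≥0∞) * reg A γ α u + ((1 / 2 : ℝ≥0) : ℝ≥0∞) * reg A γ α v) := by
          rw [hfid]; gcongr
      _ = ((1 / 2 : ℝ≥0) : ℝ≥0∞) * J u + ((1 / 2 : ℝ≥0) : ℝ≥0∞) * J v := by
          simp only [J, objective]; ring
      _ = J u := by rw [hJv, ← add_mul, hhalf, one_mul]
  have h0 : ENNReal.ofReal (1 / 8 * ‖K u - K v‖ ^ 2) ≤ 0 := by
    have h1 : J u + ENNReal.ofReal (1 / 8 * ‖K u - K v‖ ^ 2) ≤ J u + 0 := by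
      rw [add_zero]
      exact le_trans (add_le_add_left (hu.2 w) _) hsum
    exact ENNReal.le_of_add_le_add_left hJu h1
  have h1 : 1 / 8 * ‖K u - K v‖ ^ 2 ≤ 0 := ENNReal.ofReal_eq_zero.1 (nonpos_iff_eq_zero.1 h0)
  have h2 : ‖K u - K v‖ = 0 := by
    have := sq_nonneg ‖K u - K v‖
    exact pow_eq_zero_iff two_ne_zero |>.1 (by linarith)
  exact sub_eq_zero.1 (norm_eq_zero.1 h2)

/-- The objective at a fixed point is continuous in the parameters. Since `0 · ∞ = 0`, the term
`ε H` is discontinuous at `ε = 0` outside the domain of `H`, unless `ε` stays zero; `α_j ‖A_j w‖`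
causes no such problem at `α_j = ∞`, because it vanishes for all `α_j` if `A_j w = 0`. -/
theorem tendsto_objective (hΩ : IsOpen Ω) (hΩb : Bornology.IsBounded Ω)
    (hKA : AssumptionKA ι A K Kdag) {I : Type*} {l : Filter I}
    {γ : I → ℝ≥0∞} {ε : I → ℝ≥0} {α : I → Fin N → ℝ≥0∞} {γ₀ : ℝ≥0∞} {ε₀ : ℝ≥0}
    {α₀ : Fin N → ℝ≥0∞} (hγ : Tendsto γ l (𝓝 γ₀)) (hε : Tendsto ε l (𝓝 ε₀))
    (hα : Tendsto α l (𝓝 α₀)) (hγ₀ : γ₀ ≠ 0) {w : X}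
    (hw : H w ≠ ⊤ ∨ (ε₀ = 0 ∧ ∀ᶠ i in l, ε i = 0)) :
    Tendsto (fun i => objective A K f H (γ i) (ε i) (α i) w) l
      (𝓝 (objective A K f H γ₀ ε₀ α₀ w)) := by
  refine (Tendsto.add ?_ tendsto_const_nhds).add (tendsto_finsetSum _ fun j _ => ?_)
  · rcases hw with hw | ⟨h0, hw⟩
    · exact ENNReal.Tendsto.mul_const (ENNReal.tendsto_coe.2 hε) (Or.inr hw)
    · refine (tendsto_congr' ?_).2 (tendsto_const_nhds (x := (ε₀ : ℝ≥0∞) * H w))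
      filter_upwards [hw] with i hi
      rw [hi, h0]
  · have h0 := radonNorm_ne_top hKA j w
    rcases eq_or_ne (huberNorm γ₀ (A j w)) 0 with hz | hz
    · have hr := radonNorm_eq_zero_of_huberNorm hγ₀ hz
      refine (tendsto_congr' ?_).2 (tendsto_const_nhds (x := α₀ j * huberNorm γ₀ (A j w)))
      filter_upwards [hγ.eventually_ne hγ₀] with i hi
      have h1 := huberNorm_le_radonNorm hΩ hΩb hi h0
      rw [hr, nonpos_iff_eq_zero] at h1
      rw [h1, hz, mul_zero, mul_zero]
    · exact ENNReal.Tendsto.mul ((tendsto_pi_nhds.1 hα) j)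
        (Or.inr (huberNorm_ne_top hΩ hΩb hKA hγ₀ j w)) (tendsto_huberNorm hΩ hΩb hγ hγ₀ h0)
        (Or.inl hz)

/-- Near-optimality of the minimisers `u i` for the limit problem. -/
theorem eventually_objective_lt (hΩ : IsOpen Ω) (hΩb : Bornology.IsBounded Ω)
    (hKA : AssumptionKA ι A K Kdag) {I : Type*} {l : Filter I}
    {γ : I → ℝ≥0∞} {ε : I → ℝ≥0} {α : I → Fin N → ℝ≥0∞} {u : I → X} {γ₀ : ℝ≥0∞} {ε₀ : ℝ≥0}
    {α₀ : Fin N → ℝ≥0∞} (hγ : Tendsto γ l (𝓝 γ₀)) (hε : Tendsto ε l (𝓝 ε₀))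
    (hα : Tendsto α l (𝓝 α₀)) (hγ₀ : γ₀ ≠ 0)
    (hu : ∀ᶠ i in l, u i ∈ reconstructions A K f H (γ i) (ε i) (α i))
    (happ : (0 < ε₀ ∨ SmoothApprox A K f H γ₀) ∨ (ε₀ = 0 ∧ ∀ᶠ i in l, ε i = 0))
    {w : X} {c : ℝ≥0∞} (hc : objective A K f H γ₀ ε₀ α₀ w < c) :
    ∀ᶠ i in l, objective A K f H (γ i) (ε i) (α i) (u i) < c := by
  obtain ⟨w', hw', hc'⟩ : ∃ w', (H w' ≠ ⊤ ∨ (ε₀ = 0 ∧ ∀ᶠ i in l, ε i = 0)) ∧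
      objective A K f H γ₀ ε₀ α₀ w' < c := by
    rcases happ with happ | happ
    · rcases eq_or_ne ε₀ 0 with h0 | h0
      · have happ' := happ.resolve_left (by simp [h0])
        obtain ⟨δ, hδ, hδc⟩ := ENNReal.lt_iff_exists_add_pos_lt.1 hc
        obtain ⟨w', hw', hle⟩ := happ' δ hδ α₀ w
        exact ⟨w', Or.inl hw'.ne, by rw [h0] at hδc ⊢; exact hle.trans_lt hδc⟩
      · refine ⟨w, Or.inl fun htop => ?_, hc⟩
        have h1 : (ε₀ : ℝ≥0∞) * H w < ⊤ :=
          lt_of_le_of_lt (le_trans le_self_add le_self_add) (hc.trans_le le_top)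
        rw [htop, ENNReal.mul_top (by simpa using h0)] at h1
        exact lt_irrefl _ h1
    · exact ⟨w, Or.inr happ, hc⟩
  filter_upwards [hu,
    (tendsto_objective (f := f) hΩ hΩb hKA hγ hε hα hγ₀ hw').eventually_lt_const hc'] with i hi hi'
  exact (hi.2 w').trans_lt hi'

/-- Stability: the images under `K` of solutions of the inner problem depend continuously on the
parameters, wherever the approximation property allows to pass to the limit. -/
theorem tendsto_K_reconstructions (hΩ : IsOpen Ω) (hΩb : Bornology.IsBounded Ω)
    (hKA : AssumptionKA ι A K Kdag) (hH : IsSmoothing ι H) {I : Type*} {l : Filter I}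
    {γ : I → ℝ≥0∞} {ε : I → ℝ≥0} {α : I → Fin N → ℝ≥0∞} {u : I → X} {γ₀ : ℝ≥0∞} {ε₀ : ℝ≥0}
    {α₀ : Fin N → ℝ≥0∞} (hγ : Tendsto γ l (𝓝 γ₀)) (hε : Tendsto ε l (𝓝 ε₀))
    (hα : Tendsto α l (𝓝 α₀)) (hγ₀ : γ₀ ≠ 0) (hα₀ : ∀ j, α₀ j ≠ 0)
    (hε₀ : (ε₀ : ℝ≥0∞) * H 0 ≠ ⊤)
    (hu : ∀ᶠ i in l, u i ∈ reconstructions A K f H (γ i) (ε i) (α i))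
    (happ : (0 < ε₀ ∨ SmoothApprox A K f H γ₀) ∨ (ε₀ = 0 ∧ ∀ᶠ i in l, ε i = 0))
    {û : X} (hû : û ∈ reconstructions A K f H γ₀ ε₀ α₀) :
    Tendsto (fun i => K (u i)) l (𝓝 (K û)) := by
  rw [tendsto_iff_ultrafilter]
  intro 𝒰 h𝒰
  obtain ⟨v, hv, hKv⟩ := exists_limit_reconstruction (f := f) (u := u) hΩ hΩb hKA hH
    (hγ.mono_left h𝒰) (hε.mono_left h𝒰) (hα.mono_left h𝒰) hγ₀ hα₀ hε₀ fun w c hc =>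
      h𝒰 (eventually_objective_lt hΩ hΩb hKA hγ hε hα hγ₀ hu happ hc)
  rwa [K_eq_of_mem_reconstructions hΩ hΩb hKA hH hγ₀ hε₀ hû hv]

end Stability

/-! ### Descent of the outer cost near zero regularisation -/

section Descent

variable {d N : ℕ} {Ω : Set (EuclideanSpace ℝ (Fin d))} {m : Fin N → ℕ}
variable {P X Y Z : Type*}
  [NormedAddCommGroup P] [NormedSpace ℝ P] [NormedAddCommGroup X] [NormedSpace ℝ X]
  [NormedAddCommGroup Y] [InnerProductSpace ℝ Y]
  [NormedAddCommGroup Z] [InnerProductSpace ℝ Z]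
  {ι : X ≃L[ℝ] StrongDual ℝ P}
  {A : ∀ j, X →ₗ[ℝ] VectorMeasure Ω (EuclideanSpace ℝ (Fin (m j)))}
  {K : X →L[ℝ] Y} {Kdag : LinearMap.range K.toLinearMap →ₗ[ℝ] X} {K0 : X →L[ℝ] Z}
  {f : Y} {f0 : Z} {H : X → ℝ≥0∞}

theorem norm_K0_sub_le {C0 : ℝ} (hK0 : ∀ u, ‖K0 u‖ ≤ C0 * ‖K u‖) (u v : X) :
    ‖K0 u - K0 v‖ ≤ C0 * ‖K u - K v‖ := by
  rw [← map_sub, ← map_sub]; exact hK0 _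

theorem tendsto_cost {C0 : ℝ} (hK0 : ∀ u, ‖K0 u‖ ≤ C0 * ‖K u‖) {I : Type*} {l : Filter I}
    {u : I → X} {û : X} (hu : Tendsto (fun i => K (u i)) l (𝓝 (K û))) :
    Tendsto (fun i => cost K0 f0 (u i)) l (𝓝 (cost K0 f0 û)) := by
  have h1 : Tendsto (fun i => K0 (u i)) l (𝓝 (K0 û)) := by
    rw [tendsto_iff_norm_sub_tendsto_zero] at hu ⊢
    refine squeeze_zero (fun _ => norm_nonneg _) (fun i => norm_K0_sub_le hK0 (u i) û) ?_
    simpa using hu.const_mul C0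
  exact ((h1.sub_const f0).norm.pow 2).const_mul _

/-- If `K u` is close to `f`, then the cost at `u` is not much smaller than that of an exact
reconstruction. -/
theorem exists_fidelity_bound {C0 : ℝ} (hK0 : ∀ u, ‖K0 u‖ ≤ C0 * ‖K u‖) {uf : X} (huf : K uf = f)
    {η : ℝ} (hη : η < cost K0 f0 uf) :
    ∃ δ : ℝ≥0, 0 < δ ∧ ∀ u, fidelity f (K u) ≤ 3 * δ → η < cost K0 f0 u := by
  by_contra! hcon
  choose u hu hu' using fun n : ℕ => hcon (1 / ((n : ℝ≥0) + 1)) (by positivity)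
  have h1 : Tendsto (fun n => fidelity f (K (u n))) atTop (𝓝 (fidelity f f)) := by
    rw [fidelity_eq_zero_iff.2 rfl]
    refine tendsto_of_tendsto_of_tendsto_of_le_of_le tendsto_const_nhds ?_ (fun _ => zero_le) hu
    have h2 : Tendsto (fun n : ℕ => 1 / ((n : ℝ≥0) + 1)) atTop (𝓝 0) :=
      tendsto_one_div_add_atTop_nhds_zero_nat (𝕜 := ℝ≥0)
    have h3 := ENNReal.Tendsto.const_mul (a := 3) (ENNReal.tendsto_coe.2 h2)
      (Or.inr (by simp))
    simpa using h3
  have h2 : Tendsto (fun n => ‖f - K (u n)‖) atTop (𝓝 0) := by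
    have h3 := (ENNReal.tendsto_toReal (fidelity_ne_top (f := f) f)).comp h1
    have h4 : ∀ w : Y, (fidelity f w).toReal = 1 / 2 * ‖f - w‖ ^ 2 := fun w =>
      ENNReal.toReal_ofReal (by positivity)
    simp only [Function.comp_def, h4, sub_self, norm_zero] at h3
    have h5 := (Real.continuous_sqrt.tendsto _).comp (h3.const_mul 2)
    have h6 : ∀ x : ℝ, 2 * (1 / 2 * x ^ 2) = x ^ 2 := fun x => by ring
    simpa [Function.comp_def, h6, Real.sqrt_sq (norm_nonneg _)] using h5
  have h3 : Tendsto (fun n => K (u n)) atTop (𝓝 (K uf)) := by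
    rw [huf, tendsto_iff_norm_sub_tendsto_zero]
    simpa only [norm_sub_rev] using h2
  exact absurd (le_of_tendsto' (tendsto_cost (f0 := f0) hK0 h3) hu') (not_le.2 hη)

/-- If one weight is small, then every solution of the inner problem nearly fits the data: the
other regularisers vanish at suitable competitors `w ℓ` that nearly fit the data. -/
theorem exists_weight_threshold (hΩ : IsOpen Ω) (hΩb : Bornology.IsBounded Ω)
    (hKA : AssumptionKA ι A K Kdag) {δ : ℝ≥0} (hδ : 0 < δ) {w : Fin N → X}
    (hw : ∀ ℓ, fidelity f (K (w ℓ)) ≤ δ) (hw0 : ∀ ℓ, ∀ j ≠ ℓ, radonNorm (A j (w ℓ)) = 0) :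
    ∃ c : ℝ≥0∞, 0 < c ∧ ∀ (γ : ℝ≥0∞) (ε : ℝ≥0) (α : Fin N → ℝ≥0∞) (ℓ : Fin N), γ ≠ 0 →
      (ε : ℝ≥0∞) * H (w ℓ) ≤ δ → α ℓ < c → ∀ u ∈ reconstructions A K f H γ ε α,
        fidelity f (K u) ≤ 3 * δ := by
  -- Adding `1` keeps the denominator away from zero.
  refine ⟨Finset.univ.inf fun ℓ => δ / (1 + radonNorm (A ℓ (w ℓ))), ?_, ?_⟩
  · refine (Finset.lt_inf_iff ENNReal.zero_lt_top).2 fun ℓ _ =>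
      ENNReal.div_pos (by simpa using hδ.ne') ?_
    exact ENNReal.add_ne_top.2 ⟨ENNReal.one_ne_top, radonNorm_ne_top hKA _ _⟩
  intro γ ε α ℓ hγ hε hα u hu
  have hα' : α ℓ * radonNorm (A ℓ (w ℓ)) ≤ δ := by
    have h1 : α ℓ ≤ δ / (1 + radonNorm (A ℓ (w ℓ))) :=
      hα.le.trans (Finset.inf_le (Finset.mem_univ ℓ))
    calc α ℓ * radonNorm (A ℓ (w ℓ))
        ≤ δ / (1 + radonNorm (A ℓ (w ℓ))) * (1 + radonNorm (A ℓ (w ℓ))) :=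
          mul_le_mul' h1 le_add_self
      _ = δ := ENNReal.div_mul_cancel (by simp)
        (ENNReal.add_ne_top.2 ⟨ENNReal.one_ne_top, radonNorm_ne_top hKA _ _⟩)
  have hreg : reg A γ α (w ℓ) ≤ δ := by
    have h0 : ∀ j, huberNorm γ (A j (w ℓ)) ≤ radonNorm (A j (w ℓ)) := fun j =>
      huberNorm_le_radonNorm hΩ hΩb hγ (radonNorm_ne_top hKA _ _)
    have h1 : reg A γ α (w ℓ) = α ℓ * huberNorm γ (A ℓ (w ℓ)) := by
      refine Finset.sum_eq_single ℓ (fun j _ hj => ?_) (fun h => absurd (Finset.mem_univ ℓ) h)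
      have := h0 j
      rw [hw0 ℓ j hj, nonpos_iff_eq_zero] at this
      rw [this, mul_zero]
    rw [h1]
    exact (mul_le_mul' le_rfl (h0 ℓ)).trans hα'
  calc fidelity f (K u) ≤ objective A K f H γ ε α u := le_trans le_add_self le_self_add
    _ ≤ objective A K f H γ ε α (w ℓ) := hu.2 _
    _ ≤ δ + δ + δ := add_le_add (add_le_add hε (hw ℓ)) hreg
    _ = 3 * δ := by ring

/-- The defining property of the adjoint of `K₀ K†`. -/
theorem inner_adjK0Kdag [CompleteSpace Y] [CompleteSpace Z] (hKdag : ∀ v, K (Kdag v) = v) {C0 : ℝ}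
    (hK0 : ∀ u, ‖K0 u‖ ≤ C0 * ‖K u‖) (z : Z) (x : X) :
    inner ℝ (adjK0Kdag K Kdag K0 z) (K x) = inner ℝ z (K0 x) := by
  have hdense : DenseRange
      (Submodule.inclusion (LinearMap.range K.toLinearMap).le_topologicalClosure) :=
    (denseRange_inclusion_iff (s := (LinearMap.range K.toLinearMap : Set Y))
      (t := ((LinearMap.range K.toLinearMap).topologicalClosure : Set Y))
      (LinearMap.range K.toLinearMap).le_topologicalClosure).2
      (LinearMap.range K.toLinearMap).topologicalClosure_coe.le
  have hbound : ∀ v : LinearMap.range K.toLinearMap, ‖(K0.toLinearMap ∘ₗ Kdag) v‖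
      ≤ C0 * ‖Submodule.inclusion (LinearMap.range K.toLinearMap).le_topologicalClosure v‖ := by
    intro v
    have := hK0 (Kdag v)
    rwa [hKdag] at this
  let y : LinearMap.range K.toLinearMap := ⟨K x, LinearMap.mem_range_self _ x⟩
  have hT := LinearMap.extendOfNorm_eq hdense ⟨C0, hbound⟩ y
  have hy : K0 (Kdag y) = K0 x := by
    have h1 := norm_K0_sub_le hK0 (Kdag y) x
    rw [hKdag, sub_self, norm_zero, mul_zero] at h1
    exact sub_eq_zero.1 (norm_le_zero_iff.1 h1)
  calc inner ℝ (adjK0Kdag K Kdag K0 z) (K x)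
      = inner ℝ (ContinuousLinearMap.adjoint ((K0.toLinearMap ∘ₗ Kdag).extendOfNorm
          (Submodule.inclusion (LinearMap.range K.toLinearMap).le_topologicalClosure)) z)
          (Submodule.inclusion (LinearMap.range K.toLinearMap).le_topologicalClosure y) := rfl
    _ = inner ℝ z (K0 x) := by
      rw [ContinuousLinearMap.adjoint_inner_left, hT, ← hy]; rfl

theorem reg_ne_top (hΩ : IsOpen Ω) (hΩb : Bornology.IsBounded Ω) (hKA : AssumptionKA ι A K Kdag)
    {γ : ℝ≥0∞} (hγ : γ ≠ 0) (α : Fin N → ℝ≥0) (u : X) :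
    reg A γ (fun j => (α j : ℝ≥0∞)) u ≠ ⊤ :=
  ENNReal.sum_ne_top.2 fun j _ =>
    ENNReal.mul_ne_top ENNReal.coe_ne_top (huberNorm_ne_top hΩ hΩb hKA hγ j u)

/-- By convexity, the step in the strict inequality for the marginal can be taken small. -/
theorem exists_small_step (hΩ : IsOpen Ω) (hΩb : Bornology.IsBounded Ω)
    (hKA : AssumptionKA ι A K Kdag) (α : Fin N → ℝ≥0) {g : Y} {t τ : ℝ} (ht : 0 < t) (hτ : 0 < τ)
    {uf : X} (huf : K uf = f)
    (hcond : marginal A K (fun j => (α j : ℝ≥0∞)) (f - t • g)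
      < marginal A K (fun j => (α j : ℝ≥0∞)) f) :
    ∃ s, 0 < s ∧ s ≤ τ ∧ ∃ u, K u = f - s • g ∧
      reg A ⊤ (fun j => (α j : ℝ≥0∞)) u < marginal A K (fun j => (α j : ℝ≥0∞)) f := by
  set r := reg A ⊤ (fun j => (α j : ℝ≥0∞))
  set R := marginal A K (fun j => (α j : ℝ≥0∞)) f with hR
  have hfin : ∀ u, r u ≠ ⊤ := reg_ne_top hΩ hΩb hKA ENNReal.top_ne_zero α
  obtain ⟨u₁, hu₁⟩ := iInf_lt_iff.1 hcond
  obtain ⟨hKu₁, hru₁⟩ := iInf_lt_iff.1 hu₁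
  have hRtop : R ≠ ⊤ := ((iInf₂_le uf huf).trans_lt (hfin uf).lt_top).ne
  let θ : ℝ≥0 := ⟨min 1 (τ / t), by positivity⟩
  have hθ0 : 0 < (θ : ℝ) := lt_min one_pos (div_pos hτ ht)
  have hθ1 : (θ : ℝ) ≤ 1 := min_le_left _ _
  have hθt : (θ : ℝ) * t ≤ τ := (le_div_iff₀ ht).1 (min_le_right _ _)
  -- The infimum `R` need not be attained: the error at `u₀` stays below the gain at `u₁`.
  have hΔ : 0 < R - r u₁ := tsub_pos_of_lt hru₁
  have hR' : R < R + θ * (R - r u₁) := by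
    refine ENNReal.lt_add_right hRtop (mul_ne_zero ?_ hΔ.ne')
    exact_mod_cast hθ0.ne'
  obtain ⟨u₀, hu₀⟩ := iInf_lt_iff.1 (hR ▸ hR')
  obtain ⟨hKu₀, hru₀⟩ := iInf_lt_iff.1 hu₀
  have hθ1' : θ ≤ 1 := hθ1
  have hsum : (1 - θ) + θ = 1 := tsub_add_cancel_of_le hθ1'
  refine ⟨θ * t, mul_pos hθ0 ht, hθt, (1 - θ) • u₀ + θ • u₁, ?_, ?_⟩
  · rw [NNReal.smul_def, NNReal.smul_def, map_add, map_smul, map_smul, hKu₀, hKu₁,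
      NNReal.coe_sub hθ1', NNReal.coe_one]
    module
  · refine (reg_convex hΩ hΩb hKA ENNReal.top_ne_zero _ u₀ u₁ hsum).trans_lt ?_
    change ((1 - θ : ℝ≥0) : ℝ≥0∞) * r u₀ + θ * r u₁ < R
    have h1 := (ENNReal.toReal_lt_toReal (hfin u₁) hRtop).2 hru₁
    have h2 : (r u₀).toReal < R.toReal + θ * (R.toReal - (r u₁).toReal) := by
      have h3 : θ * (R - r u₁) ≠ ⊤ :=
        ENNReal.mul_ne_top ENNReal.coe_ne_top (ENNReal.sub_ne_top hRtop)
      have h4 := (ENNReal.toReal_lt_toReal (hfin u₀) (ENNReal.add_ne_top.2 ⟨hRtop, h3⟩)).2 hru₀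
      rwa [ENNReal.toReal_add hRtop h3, ENNReal.toReal_mul, ENNReal.toReal_sub_of_le hru₁.le hRtop,
        ENNReal.coe_toReal] at h4
    have h5 : ((1 - θ : ℝ≥0) : ℝ≥0∞) * r u₀ ≠ ⊤ := ENNReal.mul_ne_top ENNReal.coe_ne_top (hfin u₀)
    have h6 : (θ : ℝ≥0∞) * r u₁ ≠ ⊤ := ENNReal.mul_ne_top ENNReal.coe_ne_top (hfin u₁)
    rw [← ENNReal.toReal_lt_toReal (ENNReal.add_ne_top.2 ⟨h5, h6⟩) hRtop, ENNReal.toReal_add h5 h6,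
      ENNReal.toReal_mul, ENNReal.toReal_mul, ENNReal.coe_toReal, ENNReal.coe_toReal,
      NNReal.coe_sub hθ1', NNReal.coe_one]
    have h7 := mul_pos hθ0 (mul_pos hθ0 (sub_pos.2 h1))
    rcases eq_or_lt_of_le hθ1 with h8 | h8
    · rw [h8]; linarith
    · have h9 := mul_lt_mul_of_pos_left h2 (sub_pos.2 h8)
      nlinarith

/-- Solutions for vanishing weights `s α` have a larger regulariser than any `ρ` below the marginal
at `f`. -/
theorem exists_lt_reg (hΩ : IsOpen Ω) (hΩb : Bornology.IsBounded Ω)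
    (hKA : AssumptionKA ι A K Kdag) (α : Fin N → ℝ≥0) (hα : ∀ j, 0 < α j) {uf : X}
    (huf : K uf = f) {ρ : ℝ≥0∞} (hρ : ρ < marginal A K (fun j => (α j : ℝ≥0∞)) f)
    {s : ℕ → ℝ≥0} (hs : Tendsto s atTop (𝓝 0)) {u : ℕ → X}
    (hu : ∀ n, u n ∈ reconstructions A K f H ⊤ 0 fun j => ((s n * α j : ℝ≥0) : ℝ≥0∞)) :
    ∃ n, ρ < reg A ⊤ (fun j => (α j : ℝ≥0∞)) (u n) := by
  by_contra! hcon
  set r := reg A ⊤ (fun j => (α j : ℝ≥0∞)) with hr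
  have hfin : ∀ u, r u ≠ ⊤ := reg_ne_top hΩ hΩb hKA ENNReal.top_ne_zero α
  have hreg : ∀ (n : ℕ) (v : X), reg A ⊤ (fun j => ((s n * α j : ℝ≥0) : ℝ≥0∞)) v = s n * r v := by
    intro n v
    simp only [hr, reg, Finset.mul_sum, ENNReal.coe_mul, mul_assoc]
  have hfid : ∀ n, fidelity f (K (u n)) ≤ s n * r uf := by
    intro n
    have h1 := (hu n).2 uf
    simp only [objective, hreg, huf, fidelity_eq_zero_iff.2, ENNReal.coe_zero, zero_mul,
      zero_add] at h1
    exact le_trans le_self_add h1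
  have hlim0 : Tendsto (fun n => (s n : ℝ≥0∞) * r uf) atTop (𝓝 0) := by
    have := ENNReal.Tendsto.mul_const (ENNReal.tendsto_coe.2 hs) (Or.inr (hfin uf))
    simpa using this
  have hfid0 : Tendsto (fun n => fidelity f (K (u n))) atTop (𝓝 0) :=
    tendsto_of_tendsto_of_tendsto_of_le_of_le tendsto_const_nhds hlim0 (fun _ => zero_le) hfid
  have hρtop : ρ ≠ ⊤ := (hρ.trans_le le_top).ne
  obtain ⟨a, ha, ha'⟩ : ∃ a : ℝ≥0∞, a ≠ 0 ∧ ∀ j, a ≤ (α j : ℝ≥0∞) :=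
    ⟨Finset.univ.inf fun j => (α j : ℝ≥0∞), ((Finset.lt_inf_iff ENNReal.zero_lt_top).2
      fun j _ => by exact_mod_cast hα j).ne', fun j => Finset.inf_le (Finset.mem_univ j)⟩
  obtain ⟨C, hC⟩ := eventually_norm_le (l := atTop) (γ := fun _ => ⊤) (ε := fun _ : ℕ => 0)
    (α := fun _ j => (α j : ℝ≥0∞)) (u := u) (H := H) (f := f) (γ₁ := ⊤) (c := 1 + ρ) hΩ hΩb hKA
    ENNReal.top_ne_zero (ENNReal.add_ne_top.2 ⟨ENNReal.one_ne_top, hρtop⟩) ha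
    (Eventually.of_forall fun _ => le_rfl) (Eventually.of_forall fun _ => ha') (by
      filter_upwards [hfid0.eventually_lt_const one_pos] with n hn
      simp only [objective, ENNReal.coe_zero, zero_mul, zero_add]
      exact add_le_add hn.le (hcon n))
  let 𝒰 : Ultrafilter ℕ := hyperfilter ℕ
  have h𝒰 : (𝒰 : Filter ℕ) ≤ atTop := Nat.hyperfilter_le_atTop
  obtain ⟨û, hû⟩ := exists_tendsto_weakStar ι 𝒰 (h𝒰 hC)
  have hKû : K û = f := by
    have h1 := fidelity_le_of_tendsto (tendsto_inner_weakStar hKA hû) (hfid0.mono_left h𝒰)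
    exact fidelity_eq_zero_iff.1 (nonpos_iff_eq_zero.1 h1)
  have hx : ∀ j, ∃ y, Tendsto (fun n => (α j : ℝ≥0∞) * huberNorm ⊤ (A j (u n))) 𝒰 (𝓝 y) :=
    fun j => exists_tendsto_ultrafilter 𝒰 _
  choose y hy using hx
  have hle : r û ≤ ∑ j, y j := Finset.sum_le_sum fun j _ =>
    mul_le_of_tendsto tendsto_const_nhds (fun c hc => eventually_lt_huberNorm_weakStar hΩ hΩb hKA hû
      tendsto_const_nhds ENNReal.top_ne_zero j hc) (hy j)
  have hle' : ∑ j, y j ≤ ρ := le_of_tendsto (tendsto_finsetSum _ fun j _ => hy j)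
    (Eventually.of_forall hcon)
  exact absurd (hρ.trans_le ((iInf₂_le û hKû).trans (hle.trans hle'))) (lt_irrefl _)

/-- First-order optimality of a solution `u` of the inner problem, tested against `v`. -/
theorem variational_inequality (hΩ : IsOpen Ω) (hΩb : Bornology.IsBounded Ω)
    (hKA : AssumptionKA ι A K Kdag) (α : Fin N → ℝ≥0) {u : X}
    (hu : u ∈ reconstructions A K f H ⊤ 0 fun j => (α j : ℝ≥0∞)) (v : X) :
    inner ℝ (f - K u) (K v - K u) + (reg A ⊤ (fun j => (α j : ℝ≥0∞)) u).toReal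
      ≤ (reg A ⊤ (fun j => (α j : ℝ≥0∞)) v).toReal := by
  set r := reg A ⊤ (fun j => (α j : ℝ≥0∞))
  have hfin : ∀ u, r u ≠ ⊤ := reg_ne_top hΩ hΩb hKA ENNReal.top_ne_zero α
  set w := f - K u
  set e := K v - K u
  -- Optimality of `u` against `(1 - θ) u + θ v`, divided by `θ`; afterwards `θ → 0`.
  have key : ∀ θ : ℝ≥0, 0 < θ → θ ≤ 1 →
      inner ℝ w e + (r u).toReal - (r v).toReal ≤ θ / 2 * ‖e‖ ^ 2 := by
    intro θ h0 h1
    have hsum : (1 - θ) + θ = 1 := tsub_add_cancel_of_le h1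
    have hopt := hu.2 ((1 - θ) • u + θ • v)
    simp only [objective, ENNReal.coe_zero, zero_mul, zero_add] at hopt
    have hcv := reg_convex hΩ hΩb hKA ENNReal.top_ne_zero (fun j => (α j : ℝ≥0∞)) u v hsum
    have h2 : fidelity f (K u) + r u ≤ fidelity f (K ((1 - θ) • u + θ • v))
        + (((1 - θ : ℝ≥0) : ℝ≥0∞) * r u + θ * r v) := hopt.trans (by gcongr)
    have h5 : ((1 - θ : ℝ≥0) : ℝ≥0∞) * r u ≠ ⊤ := ENNReal.mul_ne_top ENNReal.coe_ne_top (hfin u)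
    have h6 : (θ : ℝ≥0∞) * r v ≠ ⊤ := ENNReal.mul_ne_top ENNReal.coe_ne_top (hfin v)
    have hKuv : f - K ((1 - θ) • u + θ • v) = w - (θ : ℝ) • e := by
      rw [NNReal.smul_def, NNReal.smul_def, map_add, map_smul, map_smul, NNReal.coe_sub h1,
        NNReal.coe_one]
      simp only [w, e]
      module
    have hfd : ∀ x : Y, (fidelity f x).toReal = 1 / 2 * ‖f - x‖ ^ 2 := fun x =>
      ENNReal.toReal_ofReal (by positivity)
    have h3 := ENNReal.toReal_mono (ENNReal.add_ne_top.2 ⟨fidelity_ne_top _,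
      ENNReal.add_ne_top.2 ⟨h5, h6⟩⟩) h2
    rw [ENNReal.toReal_add (fidelity_ne_top _) (hfin u), ENNReal.toReal_add (fidelity_ne_top _)
      (ENNReal.add_ne_top.2 ⟨h5, h6⟩), ENNReal.toReal_add h5 h6, ENNReal.toReal_mul,
      ENNReal.toReal_mul, ENNReal.coe_toReal, ENNReal.coe_toReal, NNReal.coe_sub h1, NNReal.coe_one,
      hfd, hfd, hKuv, norm_sub_sq_real w ((θ : ℝ) • e), inner_smul_right, norm_smul,
      Real.norm_of_nonneg θ.coe_nonneg] at h3
    have hθ : 0 < (θ : ℝ) := h0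
    have h4 : (θ : ℝ) * (inner ℝ w e + (r u).toReal - (r v).toReal)
        ≤ θ * (θ / 2 * ‖e‖ ^ 2) := by
      change 1 / 2 * ‖w‖ ^ 2 + _ ≤ _ at h3
      linarith
    exact le_of_mul_le_mul_left h4 hθ
  have hlim : Tendsto (fun n : ℕ => ((1 / ((n : ℝ≥0) + 1) : ℝ≥0) : ℝ) / 2 * ‖e‖ ^ 2) atTop
      (𝓝 0) := by
    have h2 : Tendsto (fun n : ℕ => 1 / ((n : ℝ≥0) + 1)) atTop (𝓝 0) :=
      tendsto_one_div_add_atTop_nhds_zero_nat (𝕜 := ℝ≥0)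
    have h3 := ((NNReal.tendsto_coe.2 h2).div_const 2).mul_const (‖e‖ ^ 2)
    simpa using h3
  have := ge_of_tendsto' hlim fun n => key (1 / ((n : ℝ≥0) + 1)) (by positivity)
    (div_le_one_of_le₀ le_add_self (by positivity))
  linarith

/-- Under the strict inequality for the marginal, some small positive weights give a reconstruction
with smaller cost than exact reconstructions. -/
theorem exists_cost_lt [CompleteSpace Y] [CompleteSpace Z] (hΩ : IsOpen Ω)
    (hΩb : Bornology.IsBounded Ω) (hKA : AssumptionKA ι A K Kdag) (hH : IsSmoothing ι H)
    {C0 : ℝ} (hC0 : 0 < C0) (hK0 : ∀ u, ‖K0 u‖ ≤ C0 * ‖K u‖) (α : Fin N → ℝ≥0)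
    (hα : ∀ j, 0 < α j) {t : ℝ} (ht : 0 < t) {uf : X} (huf : K uf = f)
    (hcond : marginal A K (fun j => (α j : ℝ≥0∞))
        (f - t • adjK0Kdag K Kdag K0 (K0 uf - f0))
      < marginal A K (fun j => (α j : ℝ≥0∞)) f) :
    ∃ β : Fin N → ℝ≥0, (∀ j, 0 < β j) ∧
      ∃ u ∈ reconstructions A K f H ⊤ 0 (fun j => (β j : ℝ≥0∞)),
        cost K0 f0 u < cost K0 f0 uf := by
  set z := K0 uf - f0 with hz
  set g := adjK0Kdag K Kdag K0 z
  -- The bound `2 / C₀²` makes `‖K₀ (uf - u)‖² ≤ C₀² ‖w‖²` smaller than `2 ⟪z, K₀ (uf - u)⟫` below.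
  obtain ⟨τ, hτ0, hτ, v, hKv, hrv⟩ := exists_small_step (τ := 2 / C0 ^ 2) hΩ hΩb hKA α ht
    (by positivity) huf hcond
  let s : ℕ → ℝ≥0 := fun n => 1 / ((n : ℝ≥0) + 1)
  have hs0 : ∀ n, 0 < s n := fun n => by positivity
  have hs : Tendsto s atTop (𝓝 0) := tendsto_one_div_add_atTop_nhds_zero_nat (𝕜 := ℝ≥0)
  have hne : ∀ n, (reconstructions A K f H ⊤ 0
      fun j => ((s n * α j : ℝ≥0) : ℝ≥0∞)).Nonempty := fun n =>
    nonempty_reconstructions hΩ hΩb hKA hH f ENNReal.top_ne_zero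
      (fun j => by simpa using ⟨(hs0 n).ne', (hα j).ne'⟩) (by simp)
  choose u hu using hne
  obtain ⟨n, hn⟩ := exists_lt_reg hΩ hΩb hKA α hα huf hrv hs hu
  refine ⟨fun j => s n * α j, fun j => mul_pos (hs0 n) (hα j), u n, hu n, ?_⟩
  have hvi := variational_inequality hΩ hΩb hKA (fun j => s n * α j) (hu n) v
  have hlt : (reg A ⊤ (fun j => ((s n * α j : ℝ≥0) : ℝ≥0∞)) v).toReal
      < (reg A ⊤ (fun j => ((s n * α j : ℝ≥0) : ℝ≥0∞)) (u n)).toReal := by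
    have hreg : ∀ v : X, reg A ⊤ (fun j => ((s n * α j : ℝ≥0) : ℝ≥0∞)) v
        = s n * reg A ⊤ (fun j => (α j : ℝ≥0∞)) v := fun v => by
      simp only [reg, Finset.mul_sum, ENNReal.coe_mul, mul_assoc]
    rw [hreg, hreg, ENNReal.toReal_mul, ENNReal.toReal_mul, ENNReal.coe_toReal]
    refine mul_lt_mul_of_pos_left ?_ (hs0 n)
    exact (ENNReal.toReal_lt_toReal (reg_ne_top hΩ hΩb hKA ENNReal.top_ne_zero α v)
      (reg_ne_top hΩ hΩb hKA ENNReal.top_ne_zero α (u n))).2 hn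
  -- With `w = f - K u`, optimality gives `‖w‖² < τ ⟪w, g⟫`, where `-g` is the direction of descent.
  set w := f - K (u n) with hw
  have hwK : w = K (uf - u n) := by rw [map_sub, huf]
  have hvu : K v - K (u n) = w - τ • g := by rw [hKv, hw]; abel
  rw [hvu, inner_sub_right, real_inner_self_eq_norm_sq, inner_smul_right] at hvi
  have hgw : inner ℝ w g = inner ℝ z (K0 (uf - u n)) := by
    rw [real_inner_comm, hwK]
    exact inner_adjK0Kdag hKA.right_inv hK0 z _
  set y := K0 (uf - u n) with hy
  have hmain : ‖w‖ ^ 2 < τ * inner ℝ z y := by rw [← hgw]; linarith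
  have hyw : ‖y‖ ^ 2 ≤ C0 ^ 2 * ‖w‖ ^ 2 := by
    rw [← mul_pow, hwK]
    exact pow_le_pow_left₀ (norm_nonneg _) (hK0 _) 2
  have hpos : 0 < inner ℝ z y := pos_of_mul_pos_right ((sq_nonneg _).trans_lt hmain) hτ0.le
  have hτC : C0 ^ 2 * τ ≤ 2 := by
    rwa [le_div_iff₀' (by positivity)] at hτ
  have hy2 : ‖y‖ ^ 2 < 2 * inner ℝ z y := by
    calc ‖y‖ ^ 2 ≤ C0 ^ 2 * ‖w‖ ^ 2 := hyw
      _ < C0 ^ 2 * (τ * inner ℝ z y) := mul_lt_mul_of_pos_left hmain (by positivity)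
      _ = (C0 ^ 2 * τ) * inner ℝ z y := by ring
      _ ≤ 2 * inner ℝ z y := mul_le_mul_of_nonneg_right hτC hpos.le
  have hzy : K0 (u n) - f0 = z - y := by rw [hz, hy, map_sub]; abel
  rw [cost, cost, hzy, norm_sub_sq_real]
  linarith

end Descent

/-! ### Solutions of the bilevel problem and outer semicontinuity -/

section OuterProblem

variable {d N : ℕ} {Ω : Set (EuclideanSpace ℝ (Fin d))} {m : Fin N → ℕ}
variable {P X Y Z : Type*}
  [NormedAddCommGroup P] [NormedSpace ℝ P] [NormedAddCommGroup X] [NormedSpace ℝ X]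
  [NormedAddCommGroup Y] [InnerProductSpace ℝ Y]
  [NormedAddCommGroup Z] [InnerProductSpace ℝ Z]
  {ι : X ≃L[ℝ] StrongDual ℝ P}
  {A : ∀ j, X →ₗ[ℝ] VectorMeasure Ω (EuclideanSpace ℝ (Fin (m j)))}
  {K : X →L[ℝ] Y} {Kdag : LinearMap.range K.toLinearMap →ₗ[ℝ] X} {K0 : X →L[ℝ] Z}
  {f : Y} {f0 : Z} {H : X → ℝ≥0∞}

/-- The bilevel problem has a solution with positive weights if weights with a small component are
more costly than the level `η`, and some weights are less costly. -/
theorem exists_mem_solutionMap (hΩ : IsOpen Ω) (hΩb : Bornology.IsBounded Ω)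
    (hKA : AssumptionKA ι A K Kdag) (hH : IsSmoothing ι H) {C0 : ℝ}
    (hK0 : ∀ u, ‖K0 u‖ ≤ C0 * ‖K u‖) {p : ℝ≥0∞ × ℝ≥0} (hγ : p.1 ≠ 0)
    (hε : (p.2 : ℝ≥0∞) * H 0 ≠ ⊤) {c : ℝ≥0∞} (hc : 0 < c) {η : ℝ}
    (hsmall : ∀ (α : Fin N → ℝ≥0∞) (ℓ : Fin N), α ℓ < c →
      ∀ u ∈ reconstructions A K f H p.1 p.2 α, η < cost K0 f0 u)
    (hgood : ∃ α, ∃ u ∈ reconstructions A K f H p.1 p.2 α, cost K0 f0 u < η) :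
    ∃ α ∈ solutionMap A K K0 f f0 H p, ∀ j, 0 < α j := by
  set S : Set ℝ := {x | ∃ α, ∃ u ∈ reconstructions A K f H p.1 p.2 α, cost K0 f0 u = x}
  obtain ⟨α₁, u₁, hu₁, hη⟩ := hgood
  have hbdd : BddBelow S := ⟨0, by
    rintro x ⟨α, u, -, rfl⟩
    exact mul_nonneg (by norm_num) (sq_nonneg _)⟩
  have hmem : cost K0 f0 u₁ ∈ S := ⟨α₁, u₁, hu₁, rfl⟩
  obtain ⟨x, -, hx, hxS⟩ := exists_seq_tendsto_sInf ⟨_, hmem⟩ hbdd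
  choose α u hu hux using hxS
  have hαc : ∀ᶠ n in atTop, ∀ j, c ≤ α n j := by
    filter_upwards [hx.eventually_lt_const ((csInf_le hbdd hmem).trans_lt hη)] with n hn j
    by_contra! hlt
    exact absurd (hsmall _ j hlt _ (hu n)) (by rw [hux n]; exact not_lt.2 hn.le)
  let 𝒰 : Ultrafilter ℕ := hyperfilter ℕ
  have h𝒰 : (𝒰 : Filter ℕ) ≤ atTop := Nat.hyperfilter_le_atTop
  obtain ⟨α₀, hα₀⟩ := exists_tendsto_ultrafilter 𝒰 α
  have hα₀c : ∀ j, c ≤ α₀ j := fun j =>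
    ge_of_tendsto (tendsto_pi_nhds.1 hα₀ j) ((hαc.filter_mono h𝒰).mono fun n hn => hn j)
  have hpos : ∀ j, 0 < α₀ j := fun j => hc.trans_le (hα₀c j)
  obtain ⟨û, hû⟩ := nonempty_reconstructions hΩ hΩb hKA hH f hγ (fun j => (hpos j).ne') hε
  -- The parameters are fixed, so no approximation property is needed to pass to the limit.
  have happ : (0 < p.2 ∨ SmoothApprox A K f H p.1) ∨ (p.2 = 0 ∧ ∀ᶠ _ in (𝒰 : Filter ℕ), p.2 = 0) :=
    (eq_or_ne p.2 0).elim (fun h => Or.inr ⟨h, Eventually.of_forall fun _ => h⟩)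
      fun h => Or.inl (Or.inl (pos_iff_ne_zero.2 h))
  have hlim := tendsto_cost (f0 := f0) hK0 (tendsto_K_reconstructions hΩ hΩb hKA hH
    tendsto_const_nhds tendsto_const_nhds hα₀ hγ (fun j => (hpos j).ne') hε
    (Eventually.of_forall hu) happ hû)
  have hcost : cost K0 f0 û = sInf S :=
    tendsto_nhds_unique hlim ((hx.mono_left h𝒰).congr fun n => (hux n).symm)
  exact ⟨α₀, ⟨û, hû, fun α' u' hu' => hcost.trans_le (csInf_le hbdd ⟨α', u', hu', rfl⟩)⟩, hpos⟩

/-- Outer semicontinuity of the solution map: since small weights are uniformly too costly, only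
weights bounded away from zero matter, and for these the outer cost is continuous. -/
theorem outerSemicontinuousWithinAt_solutionMap (hΩ : IsOpen Ω) (hΩb : Bornology.IsBounded Ω)
    (hKA : AssumptionKA ι A K Kdag) (hH : IsSmoothing ι H) {C0 : ℝ}
    (hK0 : ∀ u, ‖K0 u‖ ≤ C0 * ‖K u‖) {D : Set (ℝ≥0∞ × ℝ≥0)}
    (hD : ∀ q ∈ D, q.1 ≠ 0 ∧ (q.2 : ℝ≥0∞) * H 0 ≠ ⊤) {c : ℝ≥0∞} (hc : 0 < c) {η : ℝ}
    (hsmall : ∀ q ∈ D, ∀ (α : Fin N → ℝ≥0∞) (ℓ : Fin N), α ℓ < c →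
      ∀ u ∈ reconstructions A K f H q.1 q.2 α, η < cost K0 f0 u)
    (hgood : ∀ q ∈ D, ∃ α, ∃ u ∈ reconstructions A K f H q.1 q.2 α, cost K0 f0 u < η)
    {p : ℝ≥0∞ × ℝ≥0} (hp : p ∈ D)
    (happ : (0 < p.2 ∨ SmoothApprox A K f H p.1) ∨ ∀ q ∈ D, q.2 = 0) :
    OuterSemicontinuousWithinAt (solutionMap A K K0 f f0 H) D p := by
  intro q α α₀ hq hα hqp hαα₀
  have hγ := (continuous_fst.tendsto p).comp hqp
  have hε := (continuous_snd.tendsto p).comp hqp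
  choose u hu hmin using hα
  have huη : ∀ k, cost K0 f0 (u k) < η := fun k => by
    obtain ⟨α₁, u₁, hu₁, h⟩ := hgood _ (hq k)
    exact (hmin k α₁ u₁ hu₁).trans_lt h
  have hα₀c : ∀ j, c ≤ α₀ j := fun j => ge_of_tendsto' (tendsto_pi_nhds.1 hαα₀ j) fun k => by
    by_contra! hlt
    exact absurd (hsmall _ (hq k) _ j hlt _ (hu k)) (huη k).le.not_gt
  have happ' : (0 < p.2 ∨ SmoothApprox A K f H p.1) ∨
      (p.2 = 0 ∧ ∀ᶠ k in atTop, (Prod.snd ∘ q) k = 0) :=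
    happ.imp_right fun h => ⟨h p hp, Eventually.of_forall fun k => h _ (hq k)⟩
  have hlim : ∀ (α' : ℕ → Fin N → ℝ≥0∞) (α₁ : Fin N → ℝ≥0∞) (u' : ℕ → X) (u₁ : X),
      Tendsto α' atTop (𝓝 α₁) → (∀ j, c ≤ α₁ j) →
      (∀ k, u' k ∈ reconstructions A K f H (q k).1 (q k).2 (α' k)) →
      u₁ ∈ reconstructions A K f H p.1 p.2 α₁ →
      Tendsto (fun k => cost K0 f0 (u' k)) atTop (𝓝 (cost K0 f0 u₁)) :=
    fun α' α₁ u' u₁ h1 h2 h3 h4 => tendsto_cost hK0 (tendsto_K_reconstructions hΩ hΩb hKA hH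
      hγ hε h1 (hD p hp).1 (fun j => (hc.trans_le (h2 j)).ne') (hD p hp).2
      (Eventually.of_forall h3) happ' h4)
  obtain ⟨û, hû⟩ := nonempty_reconstructions hΩ hΩb hKA hH f (hD p hp).1
    (fun j => (hc.trans_le (hα₀c j)).ne') (hD p hp).2
  have hconv := hlim α α₀ u û hαα₀ hα₀c hu hû
  refine ⟨û, hû, fun α' u' hu' => ?_⟩
  by_cases hα' : ∀ j, c ≤ α' j
  · choose v hv using fun k => nonempty_reconstructions hΩ hΩb hKA hH f (hD _ (hq k)).1
      (fun j => (hc.trans_le (hα' j)).ne') (hD _ (hq k)).2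
    exact le_of_tendsto_of_tendsto' hconv (hlim (fun _ => α') α' v u' tendsto_const_nhds hα' hv hu')
      fun k => hmin k α' (v k) (hv k)
  · push Not at hα'
    obtain ⟨ℓ, hℓ⟩ := hα'
    exact (le_of_tendsto' hconv fun k => (huη k).le).trans (hsmall p hp α' ℓ hℓ u' hu').le

/-- The competitors of the order reduction, without smoothing. -/
theorem exists_competitors (hδ : AssumptionDelta A K f) {δ : ℝ≥0} (hδ0 : 0 < δ) :
    ∃ w : Fin N → X, (∀ ℓ, fidelity f (K (w ℓ)) ≤ δ) ∧
      ∀ ℓ, ∀ j ≠ ℓ, radonNorm (A j (w ℓ)) = 0 := by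
  choose w hw _ hw0 using fun ℓ => hδ ℓ δ hδ0
  have hinf : ⨅ v, fidelity f v = 0 :=
    nonpos_iff_eq_zero.1 ((iInf_le _ f).trans (fidelity_eq_zero_iff.2 rfl).le)
  refine ⟨w, fun ℓ => ?_, fun ℓ j hj => ?_⟩
  · simpa [hinf] using (hw ℓ).le
  · exact Finset.sum_eq_zero_iff.1 (hw0 ℓ) j (Finset.mem_erase.2 ⟨hj, Finset.mem_univ j⟩)

/-- The competitors of the order reduction can be taken in the domain of `H`: infinite weights keep
the other regularisers at zero in the approximation. -/
theorem exists_smooth_competitors (hδ : AssumptionDelta A K f) (happ : SmoothApprox A K f H ⊤)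
    {δ : ℝ≥0} (hδ0 : 0 < δ) :
    ∃ w : Fin N → X, (∀ ℓ, fidelity f (K (w ℓ)) ≤ δ) ∧
      (∀ ℓ, ∀ j ≠ ℓ, radonNorm (A j (w ℓ)) = 0) ∧ ∀ ℓ, H (w ℓ) ≠ ⊤ := by
  obtain ⟨v, hv, hv0⟩ := exists_competitors hδ (half_pos hδ0)
  let α : Fin N → Fin N → ℝ≥0∞ := fun ℓ j => if j = ℓ then 0 else ⊤
  choose w hwH hw using fun ℓ => happ (δ / 2) (half_pos hδ0) (α ℓ) (v ℓ)
  have hJv : ∀ ℓ, objective A K f H ⊤ 0 (α ℓ) (v ℓ) = fidelity f (K (v ℓ)) := fun ℓ => by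
    have : reg A ⊤ (α ℓ) (v ℓ) = 0 := Finset.sum_eq_zero fun j _ => by
      rcases eq_or_ne j ℓ with h | h
      · simp [α, h]
      · simp [huberNorm, hv0 ℓ j h]
    simp [objective, this]
  have hJw : ∀ ℓ, objective A K f H ⊤ 0 (α ℓ) (w ℓ) ≤ δ := fun ℓ =>
    calc objective A K f H ⊤ 0 (α ℓ) (w ℓ) ≤ (δ / 2 : ℝ≥0) + (δ / 2 : ℝ≥0) :=
          (hw ℓ).trans (add_le_add (by rw [hJv]; exact hv ℓ) le_rfl)
      _ = δ := by rw [← ENNReal.coe_add, add_halves]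
  refine ⟨w, fun ℓ => le_trans (le_trans le_add_self le_self_add) (hJw ℓ), fun ℓ j hj => ?_,
    fun ℓ => (hwH ℓ).ne⟩
  have h1 : α ℓ j * huberNorm ⊤ (A j (w ℓ)) ≤ δ :=
    (Finset.single_le_sum (f := fun j => α ℓ j * huberNorm ⊤ (A j (w ℓ))) (fun _ _ => zero_le)
      (Finset.mem_univ j)).trans (le_trans le_add_self (hJw ℓ))
  by_contra hne
  simp [α, hj, huberNorm, ENNReal.top_mul hne] at h1

/-- Weights whose reconstruction for `(∞, 0)` has cost below `η` keep this property on a rectangle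
of parameters. -/
theorem exists_rectangle_cost_lt (hΩ : IsOpen Ω) (hΩb : Bornology.IsBounded Ω)
    (hKA : AssumptionKA ι A K Kdag) (hH : IsSmoothing ι H) {C0 : ℝ}
    (hK0 : ∀ u, ‖K0 u‖ ≤ C0 * ‖K u‖) (happ : AssumptionH A K f H) {α : Fin N → ℝ≥0∞}
    (hα : ∀ j, α j ≠ 0) {u : X} (hu : u ∈ reconstructions A K f H ⊤ 0 α) {η : ℝ}
    (hη : cost K0 f0 u < η) :
    ∃ γ₁ ε₁ : ℝ≥0, 0 < γ₁ ∧ 0 < ε₁ ∧ ∀ q ∈ Icc (γ₁ : ℝ≥0∞) ⊤ ×ˢ Icc (0 : ℝ≥0) ε₁,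
      ∃ v ∈ reconstructions A K f H q.1 q.2 α, cost K0 f0 v < η := by
  have hne : ∀ q : ℝ≥0∞ × ℝ≥0, ∃ v, q.1 ≠ 0 → v ∈ reconstructions A K f H q.1 q.2 α := fun q => by
    rcases eq_or_ne q.1 0 with h | h
    · exact ⟨0, fun h' => absurd h h'⟩
    · obtain ⟨v, hv⟩ := nonempty_reconstructions hΩ hΩb hKA hH f h hα
        (ENNReal.mul_ne_top (ENNReal.coe_ne_top (r := q.2)) happ.1.ne)
      exact ⟨v, fun _ => hv⟩
  choose v hv using hne
  have hfst : Tendsto Prod.fst (𝓝 ((⊤ : ℝ≥0∞), (0 : ℝ≥0))) (𝓝 ⊤) := continuous_fst.tendsto _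
  have hsnd : Tendsto Prod.snd (𝓝 ((⊤ : ℝ≥0∞), (0 : ℝ≥0))) (𝓝 0) := continuous_snd.tendsto _
  have hlim := tendsto_cost (f0 := f0) hK0 (tendsto_K_reconstructions (u := v) hΩ hΩb hKA hH
    hfst hsnd tendsto_const_nhds ENNReal.top_ne_zero hα (by simp)
    ((hfst.eventually_ne ENNReal.top_ne_zero).mono fun q hq => hv q hq)
    (Or.inl (Or.inr happ.2)) hu)
  have hev := hlim.eventually_lt_const hη
  rw [nhds_prod_eq, eventually_prod_iff] at hev
  obtain ⟨pγ, hpγ, pε, hpε, hq⟩ := hev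
  obtain ⟨a, ha, ha'⟩ := ENNReal.nhds_top_basis.eventually_iff.1 hpγ
  obtain ⟨ε₁, hε₁, hε₁'⟩ := (nhds_bot_basis (α := ℝ≥0)).eventually_iff.1 hpε
  obtain ⟨γ₁, hγ₁, -⟩ := ENNReal.lt_iff_exists_nnreal_btwn.1 ha
  obtain ⟨ε₂, hε₂, hε₂'⟩ := exists_between hε₁
  have hγ₁0 : 0 < γ₁ := by exact_mod_cast (zero_le.trans_lt hγ₁ : (0 : ℝ≥0∞) < γ₁)
  refine ⟨γ₁, ε₂, hγ₁0, hε₂, fun q hqm => ⟨v q, hv q ?_, ?_⟩⟩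
  · exact ((ENNReal.coe_pos.2 hγ₁0).trans_le hqm.1.1).ne'
  · exact hq (ha' (hγ₁.trans_le hqm.1.1)) (hε₁' (lt_of_le_of_lt hqm.2.2 hε₂'))

end OuterProblem

end Bilevel

theorem theorem1 {d N : ℕ} {P X Y Z : Type*}
    [NormedAddCommGroup P] [NormedSpace ℝ P] [NormedAddCommGroup X] [NormedSpace ℝ X]
    [NormedAddCommGroup Y] [InnerProductSpace ℝ Y] [CompleteSpace Y]
    [NormedAddCommGroup Z] [InnerProductSpace ℝ Z] [CompleteSpace Z]
    (Ω : Set (EuclideanSpace ℝ (Fin d))) (hΩ : IsOpen Ω) (hΩb : Bornology.IsBounded Ω)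
    (m : Fin N → ℕ) (ι : X ≃L[ℝ] StrongDual ℝ P)
    (A : ∀ j, X →ₗ[ℝ] VectorMeasure Ω (EuclideanSpace ℝ (Fin (m j))))
    (K : X →L[ℝ] Y) (Kdag : LinearMap.range K.toLinearMap →ₗ[ℝ] X) (K0 : X →L[ℝ] Z)
    (hKA : Bilevel.AssumptionKA ι A K Kdag)
    (f : Y) (hf : f ∈ LinearMap.range K.toLinearMap) (f0 : Z)
    (hδ : Bilevel.AssumptionDelta A K f)
    (C0 : ℝ) (hC0 : 0 < C0) (hK0 : ∀ u, ‖K0 u‖ ≤ C0 * ‖K u‖)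
    (H : X → ℝ≥0∞) (hH : Bilevel.IsSmoothing ι H)
    (αbar : Fin N → ℝ≥0) (hαbar : ∀ j, 0 < αbar j) (t : ℝ) (ht : t ∈ Ioc 0 (1 / C0))
    (hcond :
      Bilevel.marginal A K (fun j => (αbar j : ℝ≥0∞)) f >
        Bilevel.marginal A K (fun j => (αbar j : ℝ≥0∞))
          (f - t • Bilevel.adjK0Kdag K Kdag K0 (K0 (Kdag ⟨f, hf⟩) - f0))) :
    (∃ α ∈ Bilevel.solutionMap A K K0 f f0 H (⊤, 0), ∀ j, 0 < α j) ∧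
    (Bilevel.AssumptionH A K f H →
      ∃ γbar εbar : ℝ≥0, 0 < γbar ∧ 0 < εbar ∧
        (∀ p ∈ Icc (γbar : ℝ≥0∞) ⊤ ×ˢ Icc (0 : ℝ≥0) εbar,
          ∃ α ∈ Bilevel.solutionMap A K K0 f f0 H p, ∀ j, 0 < α j) ∧
        (∀ p ∈ Icc (γbar : ℝ≥0∞) ⊤ ×ˢ Icc (0 : ℝ≥0) εbar,
          0 < p.2 ∨ Bilevel.SmoothApprox A K f H p.1 →
          Bilevel.OuterSemicontinuousWithinAt (Bilevel.solutionMap A K K0 f f0 H)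
            (Icc (γbar : ℝ≥0∞) ⊤ ×ˢ Icc (0 : ℝ≥0) εbar) p) ∧
        (∀ p ∈ Icc (γbar : ℝ≥0∞) ⊤ ×ˢ ({0} : Set ℝ≥0),
          Bilevel.OuterSemicontinuousWithinAt (Bilevel.solutionMap A K K0 f f0 H)
            (Icc (γbar : ℝ≥0∞) ⊤ ×ˢ ({0} : Set ℝ≥0)) p)) := by
  have hγ0 : (⊤ : ℝ≥0∞) ≠ 0 := ENNReal.top_ne_zero
  -- An exact reconstruction, a cheaper one with positive weights `β`, and a level `η` between them.
  obtain ⟨uf, huf, hcond'⟩ : ∃ uf, K uf = f ∧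
      Bilevel.marginal A K (fun j => (αbar j : ℝ≥0∞))
          (f - t • Bilevel.adjK0Kdag K Kdag K0 (K0 uf - f0))
        < Bilevel.marginal A K (fun j => (αbar j : ℝ≥0∞)) f :=
    ⟨Kdag ⟨f, hf⟩, hKA.right_inv _, hcond⟩
  obtain ⟨β, hβ, u, hu, hcost⟩ :=
    Bilevel.exists_cost_lt hΩ hΩb hKA hH hC0 hK0 αbar hαbar ht.1 huf hcond'
  obtain ⟨η, huη, hη⟩ := exists_between hcost
  obtain ⟨δ, hδ0, hfid⟩ := Bilevel.exists_fidelity_bound hK0 huf hη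
  constructor
  · obtain ⟨w, hw, hw0⟩ := Bilevel.exists_competitors hδ hδ0
    obtain ⟨c, hc, hthr⟩ := Bilevel.exists_weight_threshold (H := H) hΩ hΩb hKA hδ0 hw hw0
    exact Bilevel.exists_mem_solutionMap hΩ hΩb hKA hH hK0 hγ0 (by simp) hc
      (fun α ℓ hα v hv => hfid v (hthr ⊤ 0 α ℓ hγ0 (by simp) hα v hv)) ⟨_, u, hu, huη⟩
  intro hAH
  obtain ⟨w, hw, hw0, hwH⟩ := Bilevel.exists_smooth_competitors hδ hAH.2 hδ0
  obtain ⟨c, hc, hthr⟩ := Bilevel.exists_weight_threshold (H := H) hΩ hΩb hKA hδ0 hw hw0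
  obtain ⟨γ₁, ε₁, hγ₁, hε₁, hgood⟩ := Bilevel.exists_rectangle_cost_lt hΩ hΩb hKA hH hK0 hAH
    (fun j => by simpa using (hβ j).ne') hu huη
  -- `ε` has to be so small that the smoothing term is at most `δ` at the competitors `w ℓ`.
  obtain ⟨ε₂, hε₂, hεw⟩ : ∃ ε₂ : ℝ≥0, 0 < ε₂ ∧ ∀ ℓ, (ε₂ : ℝ≥0∞) * H (w ℓ) ≤ δ := by
    set h : ℝ≥0 := ∑ ℓ, (H (w ℓ)).toNNReal
    refine ⟨δ / (1 + h), by positivity, fun ℓ => ?_⟩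
    rw [← ENNReal.coe_toNNReal (hwH ℓ), ← ENNReal.coe_mul, ENNReal.coe_le_coe, div_mul_eq_mul_div,
      div_le_iff₀ (by positivity)]
    gcongr
    exact (Finset.single_le_sum (f := fun ℓ => (H (w ℓ)).toNNReal) (fun _ _ => zero_le)
      (Finset.mem_univ ℓ)).trans le_add_self
  set D := Icc (γ₁ : ℝ≥0∞) ⊤ ×ˢ Icc (0 : ℝ≥0) (min ε₁ ε₂)
  have hD : ∀ q ∈ D, q.1 ≠ 0 ∧ (q.2 : ℝ≥0∞) * H 0 ≠ ⊤ := fun q hq =>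
    ⟨((ENNReal.coe_pos.2 hγ₁).trans_le hq.1.1).ne', ENNReal.mul_ne_top ENNReal.coe_ne_top hAH.1.ne⟩
  have hsmall : ∀ q ∈ D, ∀ (α : Fin N → ℝ≥0∞) (ℓ : Fin N), α ℓ < c →
      ∀ v ∈ Bilevel.reconstructions A K f H q.1 q.2 α, η < Bilevel.cost K0 f0 v :=
    fun q hq α ℓ hα v hv => hfid v <| hthr q.1 q.2 α ℓ (hD q hq).1
      (le_trans (by gcongr; exact hq.2.2.trans (min_le_right _ _)) (hεw ℓ)) hα v hv
  have hgoodD : ∀ q ∈ D, ∃ α, ∃ v ∈ Bilevel.reconstructions A K f H q.1 q.2 α,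
      Bilevel.cost K0 f0 v < η := fun q hq =>
    ⟨_, hgood q ⟨hq.1, hq.2.1, hq.2.2.trans (min_le_left _ _)⟩⟩
  have hsub : Icc (γ₁ : ℝ≥0∞) ⊤ ×ˢ ({0} : Set ℝ≥0) ⊆ D := fun q hq =>
    ⟨hq.1, zero_le, (show q.2 = 0 from hq.2).le.trans zero_le⟩
  refine ⟨γ₁, min ε₁ ε₂, hγ₁, lt_min hε₁ hε₂, fun p hp => ?_, fun p hp happ => ?_, fun p hp => ?_⟩
  · exact Bilevel.exists_mem_solutionMap hΩ hΩb hKA hH hK0 (hD p hp).1 (hD p hp).2 hc (hsmall p hp)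
      (hgoodD p hp)
  · exact Bilevel.outerSemicontinuousWithinAt_solutionMap hΩ hΩb hKA hH hK0 hD hc hsmall hgoodD hp
      (Or.inl happ)
  · exact Bilevel.outerSemicontinuousWithinAt_solutionMap hΩ hΩb hKA hH hK0
      (fun q hq => hD q (hsub hq)) hc (fun q hq => hsmall q (hsub hq))
      (fun q hq => hgoodD q (hsub hq)) hp (Or.inr fun q hq => hq.2)
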